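/- Let $n\ge 0$ be an integer (for $n\ge1$ this is the usual setting), let $\alpha,\beta>0$, and let $u_0,v_0\in L^2(\mathbb R^n)$ be complex-valued. Write $\widehat f(\xi)=(2\pi)^{-n/2}\int_{\mathbb R^n}e^{-ix\cdot\xi}f(x)\,dx$ for the Fourier transform (extended to $L^2(\mathbb R^n)$ by Plancherel), and let $e^{it\Delta}f=\big(e^{-it|\xi|^2}\widehat f\,\big)^{\vee}$ be the solution at time $t$ of the free Schrödinger equation $\partial_tu=i\Delta u$, $u(0)=f$. For $T>0$ put $$\theta(t)=\frac{\beta(T-t)}{T(\alpha t+\beta)},\qquad \mu(t)=\frac{\beta}{\alpha t+\beta}.$$ All norms below are $L^2(\mathbb R^{2n})$ norms, in the variables $(x,y)$ or $(\xi,\eta)$, with values in $[0,\infty]$. Each inequality asserts that if its right-hand side is finite, then so is its left-hand side, and the inequality holds. (A zeroth power is $1$, and $0\cdot\infty=0$.) For all $\lambda\in\mathbb R^n$, $T>0$ and $0\le t\le T$, $$\Big\|e^{\frac{\lambda\cdot(x-y)}{\alpha t+\beta}}e^{it\Delta}u_0(x)\,e^{it\Delta}v_0(y)\Big\|\le\Big\|e^{\frac{\lambda\cdot(x-y)}{\beta}}u_0(x)\,v_0(y)\Big\|^{\theta(t)}\,\Big\|e^{\frac{\lambda\cdot(x-y)}{\alpha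 T+\beta}}e^{iT\Delta}u_0(x)\,e^{iT\Delta}v_0(y)\Big\|^{1-\theta(t)},$$ $$\Big\|e^{\frac{|x-y|^2}{(\alpha t+\beta)^2}}e^{it\Delta}u_0(x)\,e^{it\Delta}v_0(y)\Big\|\le\Big\|e^{\frac{|x-y|^2}{\beta^2}}u_0(x)\,v_0(y)\Big\|^{\theta(t)}\,\Big\|e^{\frac{|x-y|^2}{(\alpha T+\beta)^2}}e^{iT\Delta}u_0(x)\,e^{iT\Delta}v_0(y)\Big\|^{1-\theta(t)}.$$ For all $\lambda\in\mathbb R^n$ and $t\ge0$, $$\Big\|e^{\frac{\lambda\cdot(x-y)}{\alpha t+\beta}}e^{it\Delta}u_0(x)\,e^{it\Delta}v_0(y)\Big\|\le\Big\|e^{\frac{\lambda\cdot(x-y)}{\beta}}u_0(x)\,v_0(y)\Big\|^{\mu(t)}\,\Big\|e^{\frac{2\lambda\cdot(\xi-\eta)}{\alpha}}\widehat{u_0}(\xi)\,\widehat{v_0}(\eta)\Big\|^{1-\mu(t)},$$ $$\Big\|e^{\frac{|x-y|^2}{(\alpha t+\beta)^2}}e^{it\Delta}u_0(x)\,e^{it\Delta}v_0(y)\Big\|\le\Big\|e^{\frac{|x-y|^2}{\beta^2}}u_0(x)\,v_0(y)\Big\|^{\mu(t)}\,\Big\|e^{\frac{4|\xi-\eta|^2}{\alpha^2}}\widehat{u_0}(\xi)\,\widehat{v_0}(\eta)\Big\|^{1-\mu(t)}.$$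 -/

import Mathlib

open MeasureTheory FourierTransform
open scoped ENNReal

noncomputable section

/-- The Euclidean space `ℝⁿ`. -/
abbrev Rn (n : ℕ) : Type := EuclideanSpace ℝ (Fin n)

/-- The Hilbert space `L²(ℝⁿ; ℂ)`. -/
abbrev L2Rn (n : ℕ) : Type := Lp ℂ 2 (volume : Measure (Rn n))

/-- The Fourier symbol of `e^{itΔ}` with respect to the Fourier transform with kernel
`e^{-2πi x·ζ}`: since `Δ` has the symbol `-|2πζ|²` there, it is `e^{-it|2πζ|²}`. -/
def schrodingerSymbol {n : ℕ} (t : ℝ) (ζ : Rn n) : ℂ :=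
  Complex.exp (-(Complex.I * (t : ℂ) * (((2 * Real.pi * ‖ζ‖) ^ 2 : ℝ) : ℂ)))

theorem continuous_schrodingerSymbol {n : ℕ} (t : ℝ) :
    Continuous (schrodingerSymbol t : Rn n → ℂ) := by
  unfold schrodingerSymbol
  fun_prop

theorem norm_schrodingerSymbol {n : ℕ} (t : ℝ) (ζ : Rn n) : ‖schrodingerSymbol t ζ‖ = 1 := by
  rw [schrodingerSymbol, Complex.norm_exp]
  simp [-Complex.ofReal_pow]

theorem memLp_schrodingerSymbol_mul {n : ℕ} (t : ℝ) (f : L2Rn n) :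
    MemLp (fun ζ : Rn n => schrodingerSymbol t ζ * f ζ) 2 volume := by
  refine (Lp.memLp f).of_le
    ((continuous_schrodingerSymbol t).aestronglyMeasurable.mul (Lp.aestronglyMeasurable f)) ?_
  refine Filter.Eventually.of_forall fun ζ => ?_
  simp [norm_schrodingerSymbol]

/-- The free Schrödinger evolution `e^{itΔ}u₀` of `u₀ ∈ L²(ℝⁿ)`, that is, the solution at time `t`
of `∂ₜu = iΔu`, `u(0) = u₀`: the Fourier multiplier with symbol `e^{-it|2πζ|²}`, where `𝓕` is the
(Plancherel) Fourier transform of `L²(ℝⁿ)`. -/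
def freeSchrodinger {n : ℕ} (t : ℝ) (u₀ : L2Rn n) : L2Rn n :=
  𝓕⁻ ((memLp_schrodingerSymbol_mul t (𝓕 u₀)).toLp
    (fun ζ : Rn n => schrodingerSymbol t ζ * (𝓕 u₀ : L2Rn n) ζ))

/-- The Fourier transform of `u ∈ L²(ℝⁿ)` in the normalization
`û(ξ) = (2π)^{-n/2} ∫ e^{-ix·ξ} u(x) dx`, which is `(2π)^{-n/2} (𝓕 u)(ξ / (2π))` for the
transform `𝓕` with kernel `e^{-2πi x·ζ}`. -/
def unitaryFourier {n : ℕ} (u : L2Rn n) (ξ : Rn n) : ℂ :=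
  (((2 * Real.pi) ^ (-((n : ℝ) / 2)) : ℝ) : ℂ) * (𝓕 u : L2Rn n) ((2 * Real.pi)⁻¹ • ξ)

/-- The weighted norm `‖e^{w(x-y)} f(x) g(y)‖` in `L²(ℝ²ⁿ)`, an element of `[0,∞]`. -/
def interactionNorm {n : ℕ} (w : Rn n → ℝ) (f g : Rn n → ℂ) : ℝ≥0∞ :=
  eLpNorm (fun p : Rn n × Rn n => (Real.exp (w (p.1 - p.2)) : ℂ) * (f p.1 * g p.2)) 2
    ((volume : Measure (Rn n)).prod volume)

/-- The exponent `θ(t) = β(T - t) / (T(αt + β))`. -/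
def thetaExp (α β T t : ℝ) : ℝ := β * (T - t) / (T * (α * t + β))

/-- The exponent `μ(t) = β / (αt + β)`. -/
def muExp (α β t : ℝ) : ℝ := β / (α * t + β)

end

/-! For one particle and a linear weight, the bound is a three lines theorem in phase space. Put `φ
= 𝓕 u`. Multiplying `e^{itΔ}u` by `e^{C l·x}` shifts its Fourier transform by an imaginary multiple
of `l`. Moved onto a test function `G` by duality, and with the Schrödinger symbol absorbed into a
chirp, this becomes the pairing of `φ` with `e^{b l·y} G(y - i c l)`, where `b = 4πtC` and `c =
C/(2π)`. Hence `‖e^{C l·x} e^{itΔ}u‖ ≤ N` is equivalent to `PairBound φ l b c N`.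

For `C = 1/(αt+β)` the points `(b, c)` lie on the line `αb/(4π) + 2πβc = 1`. Time `0` is the point
`(0, 1/(2πβ))`, and `t → ∞` leads to `(4π/α, 0)`, where only a weight on the Fourier side is left.
The numbers `θ(t)` and `μ(t)` are the barycentric coordinates of the point of time `t` on the
segments from time `0` to time `T` and to infinity. It remains to interpolate along a segment
(`PairBound.interpolate`). With a complex parameter `z` on the segment, the pairing is holomorphic,
and the imaginary part of `z` acts on `G` by a real translation and a unimodular modulation, which
preserve its `L²` norm. An explicit factor `e^{γ(z)}` removes the scalars that these produce, and
the three lines theorem applies.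

The test functions are sums of complex Gaussians. They are entire, decay on all translates of `ℝⁿ`,
are stable under translations, modulations, chirps and the Fourier transform, and there are enough
of them to detect `L²` norms. No decay of `u` at intermediate times is assumed: it comes out of the
duality in `eLpNorm_le_of_forall_gaussSum`.

For two particles, `e^{l·(x-y)}` is a product of weights with parameters `l` and `-l`, so the linear
inequalities multiply. A Gaussian average over `l` of the squared linear inequalities, with Hölder's
inequality for the exponents `θ` and `1 - θ`, gives the quadratic ones. -/

open Matrix in
/-- The complex Gaussian `exp(-q Z·Z + w·Z)` on `ℂⁿ`. -/
noncomputable def cgauss {n : ℕ} (q : ℂ) (w Z : Fin n → ℂ) : ℂ := Complex.exp (-q * (Z ⬝ᵥ Z) + w ⬝ᵥ Z)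

/-- A real vector, regarded as a complex one. -/
def toC {n : ℕ} (x : Rn n) : Fin n → ℂ := fun i => (x i : ℂ)

/-- Linear combinations of complex Gaussians that decay on `ℝⁿ`. -/
def GaussSum (n : ℕ) : Submodule ℂ ((Fin n → ℂ) → ℂ) :=
  Submodule.span ℂ {G | ∃ q w, 0 < q.re ∧ G = cgauss q w}

/-! ### Sums of complex Gaussians: symmetries, decay, Fourier transform. -/

section GaussianSums

open Matrix

variable {n : ℕ}

theorem toC_dot (x y : Rn n) : toC x ⬝ᵥ toC y = ((inner ℝ x y : ℝ) : ℂ) := by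
  simp [toC, dotProduct, PiLp.inner_apply, mul_comm]

theorem toC_dot_self (x : Rn n) : toC x ⬝ᵥ toC x = ((‖x‖ ^ 2 : ℝ) : ℂ) := by
  rw [toC_dot, real_inner_self_eq_norm_sq]

theorem toC_add (x y : Rn n) : toC (x + y) = toC x + toC y := by
  ext i; simp [toC]

theorem toC_smul (c : ℝ) (x : Rn n) : toC (c • x) = (c : ℂ) • toC x := by
  ext i; simp [toC]

theorem continuous_toC : Continuous (toC : Rn n → Fin n → ℂ) := by
  unfold toC; fun_prop

theorem norm_toC_le (x : Rn n) : ‖toC x‖ ≤ ‖x‖ := by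
  refine (pi_norm_le_iff_of_nonneg (norm_nonneg _)).2 fun i => ?_
  simpa [toC] using PiLp.norm_apply_le x i

theorem norm_dot_le (x y : Fin n → ℂ) : ‖x ⬝ᵥ y‖ ≤ n * ‖x‖ * ‖y‖ := by
  calc ‖x ⬝ᵥ y‖ ≤ ∑ i, ‖x i * y i‖ := norm_sum_le _ _
    _ ≤ ∑ _i : Fin n, ‖x‖ * ‖y‖ := by
        refine Finset.sum_le_sum fun i _ => ?_
        rw [norm_mul]
        gcongr <;> exact norm_le_pi_norm _ i
    _ = n * ‖x‖ * ‖y‖ := by simp [mul_assoc]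

theorem cgauss_add (q : ℂ) (w Z a : Fin n → ℂ) :
    cgauss q w (Z + a) =
      Complex.exp (-q * (a ⬝ᵥ a) + w ⬝ᵥ a) * cgauss q (w - (2 * q) • a) Z := by
  simp only [cgauss, ← Complex.exp_add]
  congr 1
  simp only [add_dotProduct, dotProduct_add, sub_dotProduct, smul_dotProduct, smul_eq_mul,
    dotProduct_comm Z a]
  ring

theorem exp_mul_cgauss (q : ℂ) (w w' Z : Fin n → ℂ) :
    Complex.exp (w' ⬝ᵥ Z) * cgauss q w Z = cgauss q (w + w') Z := by
  simp only [cgauss, ← Complex.exp_add]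
  congr 1
  simp only [add_dotProduct]
  ring

theorem exp_mul_cgauss_sq (q s : ℂ) (w Z : Fin n → ℂ) :
    Complex.exp (s * (Z ⬝ᵥ Z)) * cgauss q w Z = cgauss (q - s) w Z := by
  simp only [cgauss, ← Complex.exp_add]
  congr 1
  ring

theorem cgauss_mem {q : ℂ} (hq : 0 < q.re) (w : Fin n → ℂ) : cgauss q w ∈ GaussSum n :=
  Submodule.subset_span ⟨q, w, hq, rfl⟩

theorem GaussSum.map_mem (T : ((Fin n → ℂ) → ℂ) →ₗ[ℂ] ((Fin n → ℂ) → ℂ))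
    (hT : ∀ q w, 0 < q.re → T (cgauss q w) ∈ GaussSum n) {G : (Fin n → ℂ) → ℂ}
    (hG : G ∈ GaussSum n) : T G ∈ GaussSum n := by
  have : GaussSum n ≤ (GaussSum n).comap T := by
    refine Submodule.span_le.2 ?_
    rintro _ ⟨q, w, hq, rfl⟩
    exact hT q w hq
  exact this hG

theorem GaussSum.translate {G : (Fin n → ℂ) → ℂ} (hG : G ∈ GaussSum n) (a : Fin n → ℂ) :
    (fun Z => G (Z + a)) ∈ GaussSum n := by
  refine GaussSum.map_mem (LinearMap.funLeft ℂ ℂ (fun Z => Z + a)) (fun q w hq => ?_) hG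
  convert (GaussSum n).smul_mem (Complex.exp (-q * (a ⬝ᵥ a) + w ⬝ᵥ a))
    (cgauss_mem hq (w - (2 * q) • a)) using 1
  ext Z
  simp [LinearMap.funLeft_apply, cgauss_add]

theorem GaussSum.modulate {G : (Fin n → ℂ) → ℂ} (hG : G ∈ GaussSum n) (w' : Fin n → ℂ) :
    (fun Z => Complex.exp (w' ⬝ᵥ Z) * G Z) ∈ GaussSum n := by
  refine GaussSum.map_mem (LinearMap.mulLeft ℂ (fun Z => Complex.exp (w' ⬝ᵥ Z)))
    (fun q w hq => ?_) hG
  convert cgauss_mem hq (w + w') using 1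
  ext Z
  simp [exp_mul_cgauss]

/-- Only an imaginary `s` is allowed, so that the real part of `q - s`, and with it the decay, is
unchanged. -/
theorem GaussSum.chirp {G : (Fin n → ℂ) → ℂ} (hG : G ∈ GaussSum n) {s : ℂ} (hs : s.re = 0) :
    (fun Z => Complex.exp (s * (Z ⬝ᵥ Z)) * G Z) ∈ GaussSum n := by
  refine GaussSum.map_mem (LinearMap.mulLeft ℂ (fun Z => Complex.exp (s * (Z ⬝ᵥ Z))))
    (fun q w hq => ?_) hG
  convert cgauss_mem (q := q - s) (by simpa [hs] using hq) w using 1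
  ext Z
  simp only [LinearMap.mulLeft_apply, Pi.mul_apply, exp_mul_cgauss_sq]

theorem GaussSum.differentiable {G : (Fin n → ℂ) → ℂ} (hG : G ∈ GaussSum n) :
    Differentiable ℂ G := by
  induction hG using Submodule.span_induction with
  | mem G h =>
    obtain ⟨q, w, -, rfl⟩ := h
    unfold cgauss dotProduct
    fun_prop
  | zero => exact differentiable_const 0
  | add G H _ _ hG hH => exact hG.add hH
  | smul c G _ hG => exact hG.const_smul c

/-- One Gaussian majorant serves all complex shifts and modulations of bounded size, since they
change the exponent only by terms of degree at most one in `x`. It supplies the dominating functions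
used with complex parameters below. -/
theorem GaussSum.bound {G : (Fin n → ℂ) → ℂ} (hG : G ∈ GaussSum n) {R : ℝ} (hR : 0 ≤ R) :
    ∃ C r : ℝ, 0 ≤ C ∧ 0 < r ∧ ∀ a b : Fin n → ℂ, ‖a‖ ≤ R → ‖b‖ ≤ R → ∀ x : Rn n,
      ‖Complex.exp (b ⬝ᵥ toC x) * G (toC x + a)‖ ≤ C * Real.exp (-r * ‖x‖ ^ 2) := by
  induction hG using Submodule.span_induction with
  | mem G h =>
    obtain ⟨q, w, hq, rfl⟩ := h
    set D : ℝ := n * (‖w‖ + 2 * ‖q‖ * R + R) with hD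
    have hD0 : 0 ≤ D := by positivity
    refine ⟨Real.exp (‖q‖ * (n * R * R) + n * ‖w‖ * R + D ^ 2 / (2 * q.re)), q.re / 2,
      (Real.exp_pos _).le, by positivity, fun a b ha hb x => ?_⟩
    rw [cgauss_add, mul_left_comm, exp_mul_cgauss, norm_mul, cgauss, Complex.norm_exp,
      Complex.norm_exp, ← Real.exp_add, ← Real.exp_add, Real.exp_le_exp]
    have h1 : (-q * (a ⬝ᵥ a) + w ⬝ᵥ a).re ≤ ‖q‖ * (n * R * R) + n * ‖w‖ * R := by
      refine (Complex.re_le_norm _).trans ((norm_add_le _ _).trans ?_)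
      rw [norm_mul, norm_neg]
      refine add_le_add ?_ ?_
      · refine mul_le_mul_of_nonneg_left ((norm_dot_le _ _).trans ?_) (norm_nonneg _)
        gcongr
      · refine (norm_dot_le _ _).trans ?_
        gcongr
    have h2 : ‖(w - (2 * q) • a + b) ⬝ᵥ toC x‖ ≤ D * ‖x‖ := by
      refine (norm_dot_le _ _).trans ?_
      have : ‖w - (2 * q) • a + b‖ ≤ ‖w‖ + 2 * ‖q‖ * R + R := by
        refine (norm_add_le _ _).trans (add_le_add ((norm_sub_le _ _).trans ?_) hb)
        rw [norm_smul]
        simp only [norm_mul, Complex.norm_ofNat]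
        gcongr
      rw [hD]
      gcongr
      exact norm_toC_le x
    have h3 : (-q * (toC x ⬝ᵥ toC x) + (w - (2 * q) • a + b) ⬝ᵥ toC x).re
        ≤ -q.re * ‖x‖ ^ 2 + D * ‖x‖ := by
      rw [Complex.add_re, toC_dot_self, Complex.re_mul_ofReal, Complex.neg_re]
      exact add_le_add le_rfl ((Complex.re_le_norm _).trans h2)
    -- Half of the quadratic decay absorbs the linear term, by completing the square.
    have h4 : D * ‖x‖ ≤ D ^ 2 / (2 * q.re) + q.re / 2 * ‖x‖ ^ 2 := by
      have : 0 ≤ (D - q.re * ‖x‖) ^ 2 / (2 * q.re) := by positivity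
      have e : (D - q.re * ‖x‖) ^ 2 / (2 * q.re)
        = D ^ 2 / (2 * q.re) + q.re / 2 * ‖x‖ ^ 2 - D * ‖x‖ := by
        field_simp; ring
      linarith
    linarith
  | zero => exact ⟨0, 1, le_rfl, one_pos, fun a b _ _ x => by simp⟩
  | add G H _ _ hG hH =>
    obtain ⟨C, r, hC, hr, h⟩ := hG
    obtain ⟨C', r', hC', hr', h'⟩ := hH
    refine ⟨C + C', min r r', by positivity, lt_min hr hr', fun a b ha hb x => ?_⟩
    rw [Pi.add_apply, mul_add, add_mul]
    refine (norm_add_le _ _).trans (add_le_add ((h a b ha hb x).trans ?_)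
      ((h' a b ha hb x).trans ?_))
    · gcongr; exact min_le_left _ _
    · gcongr; exact min_le_right _ _
  | smul c G _ hG =>
    obtain ⟨C, r, hC, hr, h⟩ := hG
    refine ⟨‖c‖ * C, r, by positivity, hr, fun a b ha hb x => ?_⟩
    rw [Pi.smul_apply, smul_eq_mul, mul_left_comm, norm_mul, mul_assoc]
    gcongr
    exact h a b ha hb x

theorem integrable_gaussian {r : ℝ} (hr : 0 < r) :
    Integrable (fun x : Rn n => Real.exp (-r * ‖x‖ ^ 2)) := by
  have := (GaussianFourier.integrable_cexp_neg_mul_sq_norm_add (V := Rn n) (b := (r : ℂ))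
    (by simpa using hr) 0 0).norm
  refine this.congr (Filter.Eventually.of_forall fun x => ?_)
  simp only [Complex.norm_exp]
  congr 1
  simp [← Complex.ofReal_pow]

theorem memLp_gaussian {r : ℝ} (hr : 0 < r) :
    MemLp (fun x : Rn n => Real.exp (-r * ‖x‖ ^ 2)) 2 volume := by
  refine (memLp_two_iff_integrable_sq (by fun_prop)).2 ?_
  refine (integrable_gaussian (n := n) (r := 2 * r) (by positivity)).congr
    (Filter.Eventually.of_forall fun x => ?_)
  simp only [← Real.exp_nat_mul]
  congr 1
  push_cast
  ring

theorem GaussSum.continuous_shift {G : (Fin n → ℂ) → ℂ} (hG : G ∈ GaussSum n)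
    (a b : Fin n → ℂ) :
    Continuous fun x : Rn n => Complex.exp (b ⬝ᵥ toC x) * G (toC x + a) := by
  have := (GaussSum.differentiable hG).continuous
  have h := continuous_toC (n := n)
  have : Continuous fun x : Rn n => b ⬝ᵥ toC x := by
    unfold dotProduct toC; fun_prop
  fun_prop

theorem GaussSum.memLp_shift {G : (Fin n → ℂ) → ℂ} (hG : G ∈ GaussSum n) (a b : Fin n → ℂ) :
    MemLp (fun x : Rn n => Complex.exp (b ⬝ᵥ toC x) * G (toC x + a)) 2 volume := by
  obtain ⟨C, r, hC, hr, h⟩ := GaussSum.bound hG (R := max ‖a‖ ‖b‖) (by positivity)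
  exact ((memLp_gaussian hr).const_mul C).of_le
    (GaussSum.continuous_shift hG a b).aestronglyMeasurable
    (Filter.Eventually.of_forall fun x =>
      (h a b (le_max_left _ _) (le_max_right _ _) x).trans (le_abs_self _))

theorem GaussSum.integrable_shift {G : (Fin n → ℂ) → ℂ} (hG : G ∈ GaussSum n)
    (a b : Fin n → ℂ) :
    Integrable (fun x : Rn n => Complex.exp (b ⬝ᵥ toC x) * G (toC x + a)) := by
  obtain ⟨C, r, hC, hr, h⟩ := GaussSum.bound hG (R := max ‖a‖ ‖b‖) (by positivity)
  exact ((integrable_gaussian hr).const_mul C).mono'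
    (GaussSum.continuous_shift hG a b).aestronglyMeasurable
    (Filter.Eventually.of_forall fun x => h a b (le_max_left _ _) (le_max_right _ _) x)

theorem GaussSum.memLp {G : (Fin n → ℂ) → ℂ} (hG : G ∈ GaussSum n) :
    MemLp (fun x : Rn n => G (toC x)) 2 volume := by
  simpa using GaussSum.memLp_shift hG 0 0

theorem integral_cgauss {q : ℂ} (hq : 0 < q.re) (w : Fin n → ℂ) :
    ∫ x : Rn n, cgauss q w (toC x)
      = (Real.pi / q) ^ (n / 2 : ℂ) * Complex.exp ((w ⬝ᵥ w) / (4 * q)) := by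
  have h := GaussianFourier.integral_cexp_neg_mul_sum_add hq w
  rw [← (PiLp.volume_preserving_toLp (Fin n)).integral_comp
    (MeasurableEquiv.toLp 2 _).measurableEmbedding]
  simp only [Fintype.card_fin, pow_two] at h
  exact h

/-- `K` is the Fourier transform of `G`, also along the translates of `ℝⁿ` in `ℂⁿ`. -/
def IsGaussFourier (G K : (Fin n → ℂ) → ℂ) : Prop :=
  ∀ a x : Rn n, ∫ y : Rn n, Complex.exp ((-(2 * Real.pi * Complex.I) • toC x) ⬝ᵥ toC y) *
      G (toC y + (-Complex.I) • toC a)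
    = Complex.exp (2 * Real.pi * (inner ℝ a x : ℝ)) * K (toC x)

/-- The imaginary shift by `a` changes only the linear coefficient of the Gaussian and a scalar, so
no contour has to be moved: both sides are explicit Gaussian integrals. -/
theorem isGaussFourier_cgauss {q : ℂ} (hq : 0 < q.re) (w : Fin n → ℂ) :
    IsGaussFourier (cgauss q w)
      (((Real.pi / q) ^ (n / 2 : ℂ) * Complex.exp ((w ⬝ᵥ w) / (4 * q))) •
        cgauss (Real.pi ^ 2 / q) ((-(Complex.I * Real.pi / q)) • w)) := by
  intro a x
  have hq0 : q ≠ 0 := by rintro rfl; simp at hq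
  simp only [cgauss_add]
  simp only [mul_left_comm _ (Complex.exp (-q * _ + _)), exp_mul_cgauss]
  rw [integral_const_mul, integral_cgauss hq]
  simp only [Pi.smul_apply, smul_eq_mul, cgauss]
  rw [mul_left_comm, mul_left_comm (Complex.exp (2 * _ * _)), mul_assoc ((_ : ℂ) ^ _)]
  congr 1
  simp only [← Complex.exp_add]
  congr 1
  rw [← toC_dot]
  simp only [add_dotProduct, dotProduct_add, sub_dotProduct, dotProduct_sub, smul_dotProduct,
    dotProduct_smul, smul_eq_mul, dotProduct_comm (toC a) w, dotProduct_comm (toC x) w,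
    dotProduct_comm (toC x) (toC a)]
  field_simp
  ring_nf
  simp only [Complex.I_sq]
  ring

theorem IsGaussFourier.add {G K G' K' : (Fin n → ℂ) → ℂ} (hG : G ∈ GaussSum n)
    (hG' : G' ∈ GaussSum n) (h : IsGaussFourier G K) (h' : IsGaussFourier G' K') :
    IsGaussFourier (G + G') (K + K') := by
  intro a x
  simp only [Pi.add_apply, mul_add]
  rw [integral_add (GaussSum.integrable_shift hG _ _) (GaussSum.integrable_shift hG' _ _),
    h a x, h' a x]

theorem IsGaussFourier.smul {G K : (Fin n → ℂ) → ℂ} (c : ℂ) (h : IsGaussFourier G K) :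
    IsGaussFourier (c • G) (c • K) := by
  intro a x
  simp only [Pi.smul_apply, smul_eq_mul, mul_left_comm _ c]
  rw [integral_const_mul, h a x]

theorem isGaussFourier_zero : IsGaussFourier (0 : (Fin n → ℂ) → ℂ) 0 := by
  intro a x
  simp

theorem re_pi_sq_div_pos {q : ℂ} (hq : 0 < q.re) : 0 < ((Real.pi : ℂ) ^ 2 / q).re := by
  rw [← Complex.ofReal_pow, Complex.div_re]
  have : 0 < Complex.normSq q := Complex.normSq_pos.2 (by rintro rfl; simp at hq)
  simp only [Complex.ofReal_re, Complex.ofReal_im, zero_mul, zero_div, add_zero]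
  positivity

theorem GaussSum.exists_fourier {G : (Fin n → ℂ) → ℂ} (hG : G ∈ GaussSum n) :
    ∃ K ∈ GaussSum n, IsGaussFourier G K := by
  induction hG using Submodule.span_induction with
  | mem G h =>
    obtain ⟨q, w, hq, rfl⟩ := h
    exact ⟨_, (GaussSum n).smul_mem _ (cgauss_mem (re_pi_sq_div_pos hq) _),
      isGaussFourier_cgauss hq w⟩
  | zero => exact ⟨0, zero_mem _, isGaussFourier_zero⟩
  | add G H hGm hHm hG hH =>
    obtain ⟨K, hK, h⟩ := hG
    obtain ⟨K', hK', h'⟩ := hH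
    exact ⟨K + K', add_mem hK hK', h.add hGm hHm h'⟩
  | smul c G _ hG =>
    obtain ⟨K, hK, h⟩ := hG
    exact ⟨c • K, (GaussSum n).smul_mem c hK, h.smul c⟩

/-- On the parameters, `q ↦ π²/q` is an involution, and the linear coefficient `(iπ/q)w` is sent
back to `w`. Hence every Gaussian is a nonzero multiple of the transform of a Gaussian. -/
theorem GaussSum.exists_fourierInv {K : (Fin n → ℂ) → ℂ} (hK : K ∈ GaussSum n) :
    ∃ G ∈ GaussSum n, IsGaussFourier G K := by
  induction hK using Submodule.span_induction with
  | mem K h =>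
    obtain ⟨q, w, hq, rfl⟩ := h
    have hq0 : q ≠ 0 := by rintro rfl; simp at hq
    have hpi : (Real.pi : ℂ) ≠ 0 := by simp [Real.pi_ne_zero]
    have h := (isGaussFourier_cgauss (re_pi_sq_div_pos hq) ((Complex.I * Real.pi / q) • w))
    set A : ℂ := (Real.pi / (Real.pi ^ 2 / q)) ^ (n / 2 : ℂ) * Complex.exp
      ((((Complex.I * Real.pi / q) • w) ⬝ᵥ ((Complex.I * Real.pi / q) • w)) /
        (4 * (Real.pi ^ 2 / q))) with hA
    have hA0 : A ≠ 0 := by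
      refine mul_ne_zero ?_ (Complex.exp_ne_zero _)
      rw [Ne, Complex.cpow_eq_zero_iff]
      push Not
      intro h0
      exact absurd h0 (by positivity)
    refine ⟨_, (GaussSum n).smul_mem A⁻¹ (cgauss_mem (re_pi_sq_div_pos hq)
      ((Complex.I * Real.pi / q) • w)), ?_⟩
    convert h.smul A⁻¹ using 1
    rw [smul_smul, inv_mul_cancel₀ hA0, one_smul, smul_smul]
    congr 1
    · field_simp
    · have : -(Complex.I * Real.pi / (Real.pi ^ 2 / q)) * (Complex.I * Real.pi / q) = 1 := by
        field_simp
        simp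
      rw [this, one_smul]
  | zero => exact ⟨0, zero_mem _, isGaussFourier_zero⟩
  | add K K' _ _ hK hK' =>
    obtain ⟨G, hG, h⟩ := hK
    obtain ⟨G', hG', h'⟩ := hK'
    exact ⟨G + G', add_mem hG hG', h.add hG hG' h'⟩
  | smul c K _ hK =>
    obtain ⟨G, hG, h⟩ := hK
    exact ⟨c • G, (GaussSum n).smul_mem c hG, h.smul c⟩

end GaussianSums

/-! ### Bilinear pairings, Plancherel, and duality with Gaussians. -/

section Pairing

open Matrix SchwartzMap

variable {n : ℕ}

theorem integral_mul_eq_inner {h : Rn n → ℂ} (hh : MemLp h 2 volume) (v : L2Rn n) :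
    ∫ x, v x * h x = inner ℂ hh.star.toLp v := by
  rw [L2.inner_def]
  refine integral_congr_ae ?_
  filter_upwards [hh.star.coeFn_toLp] with x hx
  rw [hx]
  simp [RCLike.inner_apply]

theorem continuous_integral_mul {h : Rn n → ℂ} (hh : MemLp h 2 volume) :
    Continuous fun v : L2Rn n => ∫ x, v x * h x := by
  simp only [integral_mul_eq_inner hh]
  fun_prop

theorem norm_integral_mul_le {f h : Rn n → ℂ} (hf : MemLp f 2 volume) (hh : MemLp h 2 volume) :
    ‖∫ x, f x * h x‖ ≤ (eLpNorm f 2 volume).toReal * (eLpNorm h 2 volume).toReal := by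
  have e : ∫ x, f x * h x = ∫ x, (hf.toLp f : L2Rn n) x * h x := by
    refine integral_congr_ae ?_
    filter_upwards [hf.coeFn_toLp] with x hx
    rw [hx]
  rw [e, integral_mul_eq_inner hh, mul_comm]
  refine (norm_inner_le_norm _ _).trans (le_of_eq ?_)
  rw [Lp.norm_toLp, Lp.norm_toLp]
  congr 2
  exact eLpNorm_congr_norm_ae (Filter.Eventually.of_forall fun x => by simp)

theorem integrable_mul_of_memLp {f h : Rn n → ℂ} (hf : MemLp f 2 volume)
    (hh : MemLp h 2 volume) : Integrable (fun x => f x * h x) :=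
  MemLp.integrable_mul hf hh

theorem integral_fourier_mul_eq {f h : Rn n → ℂ} (hf : Integrable f) (hh : Integrable h) :
    ∫ x, 𝓕 f x * h x = ∫ x, f x * 𝓕 h x := by
  have := VectorFourier.integral_fourierIntegral_smul_eq_flip (μ := (volume : Measure (Rn n)))
    (ν := (volume : Measure (Rn n))) (L := innerₗ (Rn n)) Real.continuous_fourierChar
    continuous_inner hf hh
  simpa only [flip_innerₗ, smul_eq_mul] using! this

/-- Both sides are continuous in `v` for the `L²` norm, and on the dense set of Schwartz functions
the identity is the one for integrable functions. -/
theorem L2_integral_fourier_mul_eq {h : Rn n → ℂ} (hh : Integrable h) (hh2 : MemLp h 2 volume)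
    (hF : MemLp (𝓕 h) 2 volume) (v : L2Rn n) :
    ∫ x, (𝓕 v : L2Rn n) x * h x = ∫ x, v x * 𝓕 h x := by
  refine DenseRange.induction_on (p := fun v : L2Rn n => ∫ x, (𝓕 v : L2Rn n) x * h x
    = ∫ x, v x * 𝓕 h x) (SchwartzMap.denseRange_toLpCLM (p := 2) ENNReal.ofNat_ne_top) v
    (isClosed_eq ?_ (continuous_integral_mul hF)) fun f => ?_
  · exact (continuous_integral_mul hh2).comp
      (ContinuousFourier.continuous_fourier (E := L2Rn n) (F := L2Rn n))
  · have e1 : ∫ x, (𝓕 (f.toLp 2 volume) : L2Rn n) x * h x = ∫ x, 𝓕 (f : Rn n → ℂ) x * h x := by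
      rw [SchwartzMap.toLp_fourier_eq]
      refine integral_congr_ae ?_
      filter_upwards [(𝓕 f).coeFn_toLp 2 volume] with x hx
      rw [hx, SchwartzMap.fourier_coe]
    have e2 : ∫ x, (f.toLp 2 volume) x * 𝓕 h x = ∫ x, f x * 𝓕 h x := by
      refine integral_congr_ae ?_
      filter_upwards [f.coeFn_toLp 2 volume] with x hx
      rw [hx]
    simp only [SchwartzMap.toLpCLM_apply]
    rw [e1, e2]
    exact integral_fourier_mul_eq f.integrable hh

/-- A smooth compactly supported test function is the Fourier transform of a Schwartz function, so
its integral against `h` can be moved onto `𝓕 h = 0`. -/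
theorem ae_eq_zero_of_fourier_eq_zero {h : Rn n → ℂ} (hh : Integrable h) (h0 : 𝓕 h = 0) :
    h =ᵐ[volume] 0 := by
  refine ae_eq_zero_of_integral_contDiff_smul_eq_zero hh.locallyIntegrable fun g hg hgc => ?_
  have hgc' : HasCompactSupport fun x => (g x : ℂ) :=
    hgc.comp_left (g := fun r : ℝ => (r : ℂ)) Complex.ofReal_zero
  have hg' : ContDiff ℝ ((⊤ : ℕ∞) : WithTop ℕ∞) fun x => (g x : ℂ) :=
    Complex.ofRealCLM.contDiff.comp hg
  let s : 𝓢(Rn n, ℂ) := hgc'.toSchwartzMap hg'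
  have e : ∀ x, (g x : ℂ) = 𝓕 ((𝓕⁻ s : 𝓢(Rn n, ℂ)) : Rn n → ℂ) x := fun x => by
    rw [← SchwartzMap.fourier_coe, fourier_fourierInv_eq]
    rfl
  have : ∀ x, g x • h x = 𝓕 ((𝓕⁻ s : 𝓢(Rn n, ℂ)) : Rn n → ℂ) x * h x := fun x => by
    rw [← e, Complex.real_smul]
  simp only [this]
  rw [integral_fourier_mul_eq (𝓕⁻ s : 𝓢(Rn n, ℂ)).integrable hh, h0]
  simp

theorem IsGaussFourier.fourier_eq {G K : (Fin n → ℂ) → ℂ} (h : IsGaussFourier G K) (a : Rn n) :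
    𝓕 (fun y : Rn n => G (toC y + (-Complex.I) • toC a))
      = fun x => Complex.exp (2 * Real.pi * (inner ℝ a x : ℝ)) * K (toC x) := by
  ext x
  rw [← h a x, Real.fourier_eq']
  refine integral_congr_ae (Filter.Eventually.of_forall fun y => ?_)
  simp only [smul_eq_mul]
  congr 2
  rw [smul_dotProduct, toC_dot, real_inner_comm, smul_eq_mul]
  push_cast
  ring

theorem exp_inner_eq (a x : Rn n) : Complex.exp (2 * Real.pi * (inner ℝ a x : ℝ))
    = Complex.exp (((2 * Real.pi : ℂ) • toC a) ⬝ᵥ toC x) := by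
  rw [smul_dotProduct, toC_dot, smul_eq_mul]

theorem IsGaussFourier.integral_eq {G K : (Fin n → ℂ) → ℂ} (hG : G ∈ GaussSum n)
    (hK : K ∈ GaussSum n) (h : IsGaussFourier G K) (a : Rn n) (v : L2Rn n) :
    ∫ y, (𝓕 v : L2Rn n) y * G (toC y + (-Complex.I) • toC a)
      = ∫ x, v x * (Complex.exp (2 * Real.pi * (inner ℝ a x : ℝ)) * K (toC x)) := by
  have e : ∀ x, Complex.exp (2 * Real.pi * (inner ℝ a x : ℝ)) * K (toC x)
      = 𝓕 (fun y : Rn n => G (toC y + (-Complex.I) • toC a)) x := fun x => by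
    rw [h.fourier_eq a]
  simp only [e]
  refine L2_integral_fourier_mul_eq ?_ ?_ ?_ v
  · simpa using GaussSum.integrable_shift hG (-Complex.I • toC a) 0
  · simpa using GaussSum.memLp_shift hG (-Complex.I • toC a) 0
  · rw [h.fourier_eq a]
    simpa [exp_inner_eq] using GaussSum.memLp_shift hK 0 ((2 * Real.pi : ℂ) • toC a)

/-- The `L²(ℝⁿ)` norm of the restriction of `G` to `ℝⁿ`. -/
noncomputable def realNorm (G : (Fin n → ℂ) → ℂ) : ℝ :=
  (eLpNorm (fun x : Rn n => G (toC x)) 2 volume).toReal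

theorem realNorm_nonneg (G : (Fin n → ℂ) → ℂ) : 0 ≤ realNorm G := ENNReal.toReal_nonneg

theorem integral_mul_star_toLp {h : Rn n → ℂ} (hh : MemLp h 2 volume) :
    ∫ x, (hh.star.toLp (star h) : L2Rn n) x * h x = (((eLpNorm h 2 volume).toReal ^ 2 : ℝ) : ℂ) := by
  rw [integral_mul_eq_inner hh, inner_self_eq_norm_sq_to_K, Lp.norm_toLp]
  have : eLpNorm (star h) 2 volume = eLpNorm h 2 volume :=
    eLpNorm_congr_norm_ae (Filter.Eventually.of_forall fun x => by simp)
  rw [this]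
  norm_cast

theorem norm_star_toLp {h : Rn n → ℂ} (hh : MemLp h 2 volume) :
    ‖hh.star.toLp‖ = (eLpNorm h 2 volume).toReal := by
  rw [Lp.norm_toLp]
  congr 1
  exact eLpNorm_congr_norm_ae (Filter.Eventually.of_forall fun x => by simp)

theorem IsGaussFourier.integral_eq' {G K : (Fin n → ℂ) → ℂ} (hG : G ∈ GaussSum n)
    (hK : K ∈ GaussSum n) (h : IsGaussFourier G K) (v : L2Rn n) :
    ∫ y, (𝓕 v : L2Rn n) y * G (toC y) = ∫ x, v x * K (toC x) := by
  have := h.integral_eq hG hK 0 v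
  simpa [show toC (0 : Rn n) = 0 by ext i; simp [toC]] using this

theorem norm_Lp_mul_le {h : Rn n → ℂ} (hh : MemLp h 2 volume) (v : L2Rn n) :
    ‖∫ x, v x * h x‖ ≤ ‖v‖ * (eLpNorm h 2 volume).toReal :=
  norm_integral_mul_le (Lp.memLp v) hh

/-- Pairing with the conjugate of `G` or of `K` and using that `𝓕` is isometric on `L²` gives `‖G‖²
≤ ‖G‖‖K‖` and `‖K‖² ≤ ‖K‖‖G‖`. -/
theorem IsGaussFourier.realNorm_eq {G K : (Fin n → ℂ) → ℂ} (hG : G ∈ GaussSum n)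
    (hK : K ∈ GaussSum n) (h : IsGaussFourier G K) : realNorm G = realNorm K := by
  have hGm := GaussSum.memLp hG
  have hKm := GaussSum.memLp hK
  have key : ∀ a b : ℝ, 0 ≤ a → 0 ≤ b → a ^ 2 ≤ a * b → a ≤ b := by
    intro a b ha hb hab
    rcases ha.eq_or_lt with rfl | ha
    · exact hb
    · nlinarith
  refine le_antisymm (key _ _ (realNorm_nonneg _) (realNorm_nonneg _) ?_)
    (key _ _ (realNorm_nonneg _) (realNorm_nonneg _) ?_)
  · have e := h.integral_eq' hG hK (𝓕⁻ hGm.star.toLp)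
    rw [fourier_fourierInv_eq, integral_mul_star_toLp hGm] at e
    have := norm_Lp_mul_le hKm (𝓕⁻ hGm.star.toLp)
    rw [← e, ← Lp.norm_fourier_eq, fourier_fourierInv_eq, norm_star_toLp hGm,
      Complex.norm_real, Real.norm_of_nonneg (sq_nonneg _)] at this
    exact this
  · have e := h.integral_eq' hG hK hKm.star.toLp
    rw [integral_mul_star_toLp hKm] at e
    have := norm_Lp_mul_le hGm (𝓕 hKm.star.toLp)
    rw [e, Lp.norm_fourier_eq, norm_star_toLp hKm,
      Complex.norm_real, Real.norm_of_nonneg (sq_nonneg _)] at this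
    exact this

/-- The restriction to `ℝⁿ` of a sum of Gaussians, as an element of `L²`. -/
noncomputable def GaussSum.toL2 : GaussSum n →ₗ[ℂ] L2Rn n where
  toFun G := (GaussSum.memLp G.2).toLp
  map_add' _ _ := rfl
  map_smul' _ _ := rfl

theorem GaussSum.norm_toL2 (G : GaussSum n) : ‖GaussSum.toL2 G‖ = realNorm G.1 := by
  change ‖(GaussSum.memLp G.2).toLp‖ = _
  rw [Lp.norm_toLp]
  rfl

theorem GaussSum.coeFn_toL2 (G : GaussSum n) :
    GaussSum.toL2 G =ᵐ[volume] fun x => G.1 (toC x) :=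
  (GaussSum.memLp G.2).coeFn_toLp

theorem GaussSum.memLp_exp_mul {G : (Fin n → ℂ) → ℂ} (hG : G ∈ GaussSum n) (a : Rn n) :
    MemLp (fun x : Rn n => Complex.exp (2 * Real.pi * (inner ℝ a x : ℝ)) * G (toC x)) 2
      volume := by
  simpa [exp_inner_eq] using GaussSum.memLp_shift hG 0 ((2 * Real.pi : ℂ) • toC a)

/-- Riesz representation, after a Hahn–Banach extension from the Gaussian sums to all of `L²`. -/
theorem exists_L2_of_forall_gaussSum {N : ℝ} (hN : 0 ≤ N) (ℓ : GaussSum n →ₗ[ℂ] ℂ)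
    (h : ∀ G, ‖ℓ G‖ ≤ N * realNorm G.1) :
    ∃ ψ : L2Rn n, ‖ψ‖ ≤ N ∧ ∀ G, ℓ G = ∫ x, star (ψ x) * G.1 (toC x) := by
  have hb : ∀ G, ‖ℓ G‖ ≤ N * ‖GaussSum.toL2 G‖ := fun G => by
    rw [GaussSum.norm_toL2]; exact h G
  -- The bound `hb` makes `ℓ` factor through the range of `toL2`; injectivity of `toL2` is not
  -- needed.
  obtain ⟨g, hg, hgn⟩ := exists_extension_norm_eq _ (ℓ.compLeftInverse GaussSum.toL2)
  have hgN : ‖g‖ ≤ N := by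
    rw [hgn]
    refine ContinuousLinearMap.opNorm_le_bound _ hN ?_
    rintro ⟨_, G, rfl⟩
    rw [LinearMap.compLeftInverse_apply_of_bdd _ _ ⟨N, hb⟩ G _ rfl]
    exact hb G
  refine ⟨(InnerProductSpace.toDual ℂ (L2Rn n)).symm g, by simpa using hgN, fun G => ?_⟩
  have e : g (GaussSum.toL2 G) = ℓ G := by
    rw [← LinearMap.compLeftInverse_apply_of_bdd ℓ GaussSum.toL2 ⟨N, hb⟩ G _ rfl]
    exact hg ⟨GaussSum.toL2 G, G, rfl⟩
  rw [← e, ← InnerProductSpace.toDual_symm_apply (y := g), L2.inner_def]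
  refine integral_congr_ae ?_
  filter_upwards [GaussSum.coeFn_toL2 G] with x hx
  rw [hx]
  simp [RCLike.inner_apply, mul_comm]

/-- A locally integrable function is determined by its integrals against Gaussians. -/
theorem ae_eq_zero_of_integral_gaussSum {f : Rn n → ℂ}
    (hf : Integrable fun x => f x * cgauss 1 0 (toC x))
    (h : ∀ G ∈ GaussSum n, ∫ x, f x * G (toC x) = 0) : f =ᵐ[volume] 0 := by
  have : (fun x => f x * cgauss 1 0 (toC x)) =ᵐ[volume] 0 := by
    refine ae_eq_zero_of_fourier_eq_zero hf ?_
    ext k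
    rw [Real.fourier_eq']
    refine Eq.trans (integral_congr_ae (Filter.Eventually.of_forall fun x => ?_))
      -- The value at `k` of the Fourier transform of `f e^{-|x|²}` is the integral of `f` against a
      -- modulated Gaussian, again a test function.
      (h (cgauss 1 (0 + (-(2 * Real.pi * Complex.I) • toC k))) (cgauss_mem (by simp) _))
    simp only [smul_eq_mul]
    rw [← exp_mul_cgauss, mul_left_comm]
    congr 3
    rw [smul_dotProduct, toC_dot, real_inner_comm, smul_eq_mul]
    push_cast
    ring
  filter_upwards [this] with x hx
  exact (mul_eq_zero.1 hx).resolve_right (Complex.exp_ne_zero _)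

/-- The weighted function is not known to lie in `L²`. The functional it defines is represented by
some `ψ` of norm at most `N`, and the weighted function equals `star ψ` almost everywhere because
Gaussians separate the two. -/
theorem eLpNorm_le_of_forall_gaussSum {N : ℝ} (hN : 0 ≤ N) (a : Rn n) (v : L2Rn n)
    (h : ∀ G ∈ GaussSum n, ‖∫ x, v x *
      (Complex.exp (2 * Real.pi * (inner ℝ a x : ℝ)) * G (toC x))‖ ≤ N * realNorm G) :
    eLpNorm (fun x => Complex.exp (2 * Real.pi * (inner ℝ a x : ℝ)) * v x) 2 volume
      ≤ ENNReal.ofReal N := by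
  have hint : ∀ G ∈ GaussSum n, Integrable fun x => v x *
      (Complex.exp (2 * Real.pi * (inner ℝ a x : ℝ)) * G (toC x)) := fun G hG =>
    integrable_mul_of_memLp (Lp.memLp v) (GaussSum.memLp_exp_mul hG a)
  obtain ⟨ψ, hψ, hψG⟩ := exists_L2_of_forall_gaussSum hN
    { toFun := fun G : GaussSum n => ∫ x, v x *
        (Complex.exp (2 * Real.pi * (inner ℝ a x : ℝ)) * G.1 (toC x))
      map_add' := fun G H => by
        rw [← integral_add (hint _ G.2) (hint _ H.2)]
        simp only [Submodule.coe_add, Pi.add_apply, mul_add]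
      map_smul' := fun c G => by
        simp only [Submodule.coe_smul, Pi.smul_apply, smul_eq_mul, RingHom.id_apply,
          mul_left_comm _ c]
        rw [integral_const_mul] } (fun G => h G.1 G.2)
  have hψint : ∀ G ∈ GaussSum n, Integrable fun x => star (ψ x) * G (toC x) := fun G hG =>
    integrable_mul_of_memLp (Lp.memLp ψ).star (GaussSum.memLp hG)
  have hsub : ∀ G : (Fin n → ℂ) → ℂ, ∀ x,
      (Complex.exp (2 * Real.pi * (inner ℝ a x : ℝ)) * v x - star (ψ x)) * G (toC x)
      = v x * (Complex.exp (2 * Real.pi * (inner ℝ a x : ℝ)) * G (toC x))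
        - star (ψ x) * G (toC x) := fun G x => by ring
  have hz := ae_eq_zero_of_integral_gaussSum
    (f := fun x => Complex.exp (2 * Real.pi * (inner ℝ a x : ℝ)) * v x - star (ψ x))
    (by
      have hc : cgauss 1 0 ∈ GaussSum n := cgauss_mem (by simp) 0
      simp only [hsub]
      exact (hint _ hc).sub (hψint _ hc))
    (fun G hG => by
      simp only [hsub]
      rw [integral_sub (hint G hG) (hψint G hG), sub_eq_zero]
      exact hψG ⟨G, hG⟩)
  have : eLpNorm (fun x => Complex.exp (2 * Real.pi * (inner ℝ a x : ℝ)) * v x) 2 volume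
      = eLpNorm ψ 2 volume := by
    refine eLpNorm_congr_norm_ae ?_
    filter_upwards [hz] with x hx
    rw [sub_eq_zero.1 hx, norm_star]
  rw [this, ← ENNReal.ofReal_toReal (Lp.memLp ψ).eLpNorm_ne_top, ← Lp.norm_def]
  exact ENNReal.ofReal_le_ofReal hψ

end Pairing

/-! ### The three lines argument for the pairing. -/

section Interpolation

open Matrix

variable {n : ℕ}

/-- The pairing of `φ` with `e^{B·y} G(y + A)`. -/
noncomputable def gaussPair (φ : L2Rn n) (G : (Fin n → ℂ) → ℂ) (A B : Fin n → ℂ) : ℂ :=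
  ∫ y, φ y * (Complex.exp (B ⬝ᵥ toC y) * G (toC y + A))

theorem differentiable_gaussPair (φ : L2Rn n) {G : (Fin n → ℂ) → ℂ} (hG : G ∈ GaussSum n)
    (A A' B B' : Fin n → ℂ) :
    Differentiable ℂ fun z : ℂ => gaussPair φ G (A + z • A') (B + z • B') := by
  intro z₀
  have hGd := GaussSum.differentiable hG
  set f : Rn n → ℂ → ℂ := fun y z =>
    Complex.exp ((B + z • B') ⬝ᵥ toC y) * G (toC y + (A + z • A')) with hf
  have hfd : ∀ y, Differentiable ℂ (f y) := fun y => by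
    have : Differentiable ℂ fun z : ℂ => (B + z • B') ⬝ᵥ toC y := by
      simp only [add_dotProduct, smul_dotProduct]
      fun_prop
    have h2 : Differentiable ℂ fun z : ℂ => G (toC y + (A + z • A')) :=
      hGd.comp (by fun_prop)
    exact this.cexp.mul h2
  have hfc : Continuous (Function.uncurry f) := by
    have h1 := continuous_toC (n := n)
    have h2 := hGd.continuous
    have : Continuous fun p : Rn n × ℂ => (B + p.2 • B') ⬝ᵥ toC p.1 := by
      unfold dotProduct toC; fun_prop
    simp only [hf, Function.uncurry_def]
    fun_prop
  obtain ⟨C, r, hC, hr, hb⟩ := GaussSum.bound hG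
    (R := ‖A‖ + (‖z₀‖ + 2) * ‖A'‖ + (‖B‖ + (‖z₀‖ + 2) * ‖B'‖)) (by positivity)
  have hbound : ∀ y, ∀ z ∈ Metric.closedBall z₀ 2, ‖f y z‖ ≤ C * Real.exp (-r * ‖y‖ ^ 2) := by
    intro y z hz
    have hz' : ‖z‖ ≤ ‖z₀‖ + 2 := by
      have := norm_le_norm_add_norm_sub' z z₀
      rw [Metric.mem_closedBall, dist_eq_norm] at hz
      linarith
    have hl : ∀ A A' : Fin n → ℂ, ‖A + z • A'‖ ≤ ‖A‖ + (‖z₀‖ + 2) * ‖A'‖ := fun A A' => by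
      refine (norm_add_le _ _).trans ?_
      rw [norm_smul]
      gcongr
    exact hb _ _ ((hl A A').trans (le_add_of_nonneg_right (by positivity)))
      ((hl B B').trans (le_add_of_nonneg_left (by positivity))) y
  -- Cauchy's estimate on a unit circle; since `z` is within `1` of `z₀`, this circle lies in the
  -- ball of radius `2` where `hbound` holds.
  have hderiv : ∀ y, ∀ z ∈ Metric.ball z₀ 1, ‖deriv (f y) z‖ ≤ C * Real.exp (-r * ‖y‖ ^ 2) := by
    intro y z hz
    have := Complex.norm_deriv_le_of_forall_mem_sphere_norm_le one_pos (hfd y).diffContOnCl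
      (fun w hw => hbound y w (?_ : w ∈ Metric.closedBall z₀ 2)) (c := z)
    · simpa using this
    · rw [Metric.mem_closedBall]
      rw [Metric.mem_sphere] at hw
      rw [Metric.mem_ball] at hz
      linarith [dist_triangle w z z₀]
  have hφ := (Lp.memLp φ)
  have hfm : ∀ z, AEStronglyMeasurable (fun y => f y z) volume := fun z =>
    (hfc.comp (by fun_prop : Continuous fun y : Rn n => (y, z))).aestronglyMeasurable
  have hfL : MemLp (fun y => f y z₀) 2 volume :=
    ((memLp_gaussian hr).const_mul C).of_le (hfm z₀) (Filter.Eventually.of_forall fun y =>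
      (hbound y z₀ (Metric.mem_closedBall_self (by norm_num))).trans (le_abs_self _))
  have hbi : Integrable fun y => ‖φ y‖ * (C * Real.exp (-r * ‖y‖ ^ 2)) :=
    MemLp.integrable_mul hφ.norm ((memLp_gaussian hr).const_mul C)
  refine (hasDerivAt_integral_of_dominated_loc_of_deriv_le
    (F := fun z y => φ y * f y z) (F' := fun z y => φ y * deriv (f y) z)
    (Metric.ball_mem_nhds z₀ one_pos)
    (Filter.Eventually.of_forall fun z => hφ.1.mul (hfm z))
    (integrable_mul_of_memLp hφ hfL)
    (hφ.1.mul ((measurable_deriv_with_param hfc).comp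
      (measurable_prodMk_right (y := z₀))).aestronglyMeasurable)
    (Filter.Eventually.of_forall fun y z hz => ?_) hbi
    (Filter.Eventually.of_forall fun y z _ => ?_)).2.differentiableAt
  · rw [norm_mul]
    gcongr
    exact hderiv y z hz
  · exact (hfd y z).hasDerivAt.const_mul _

/-- An a priori bound on the strip. Its exponential growth in `Im z` is harmless, because a factor
`e^{ηz(z-1)}` will dominate it. -/
theorem norm_gaussPair_le (φ : L2Rn n) {G : (Fin n → ℂ) → ℂ} (hG : G ∈ GaussSum n)
    (l : Rn n) (b₀ c₀ ε δ : ℝ) : ∃ C k : ℝ, 0 ≤ C ∧ 0 ≤ k ∧ ∀ z : ℂ, 0 ≤ z.re → z.re ≤ 1 →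
      ‖gaussPair φ G ((-Complex.I * (c₀ + z * δ)) • toC l) ((b₀ + z * ε : ℂ) • toC l)‖
        ≤ C * Real.exp (k * |z.im|) := by
  obtain ⟨C, r, hC, hr, hb⟩ := GaussSum.bound hG
    (R := (|c₀| + |δ|) * ‖toC l‖ + (|b₀| + |ε|) * ‖toC l‖) (by positivity)
  set g : Rn n → ℝ := fun x => Real.exp (-r * ‖x‖ ^ 2) with hg
  have hgL : MemLp g 2 volume := memLp_gaussian hr
  refine ⟨‖φ‖ * (C * (eLpNorm g 2 volume).toReal), (|b₀| + |ε|) * |δ| * ‖l‖ ^ 2,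
    by positivity, by positivity, fun z h0 h1 => ?_⟩
  set K := Real.exp ((|b₀| + |ε|) * |δ| * ‖l‖ ^ 2 * |z.im|) with hK
  have habs : ∀ x y : ℝ, |x + z.re * y| ≤ |x| + |y| := fun x y => by
    refine (abs_add_le _ _).trans ?_
    rw [abs_mul, abs_of_nonneg h0]
    have := abs_nonneg y
    nlinarith
  have hT : ∀ y : Rn n, ‖Complex.exp (((b₀ + z * ε : ℂ) • toC l) ⬝ᵥ toC y) *
      G (toC y + (-Complex.I * (c₀ + z * δ)) • toC l)‖
      ≤ K * C * g (y + (z.im * δ) • l) := by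
    intro y
    -- The imaginary part of `z` contributes `-i · i (Im z) δ l = (Im z) δ l`, a real translation,
    -- which does not change `L²` norms.
    have e1 : toC y + (-Complex.I * (c₀ + z * δ)) • toC l
        = toC (y + (z.im * δ) • l) + (-Complex.I * ((c₀ + z.re * δ : ℝ) : ℂ)) • toC l := by
      rw [toC_add, toC_smul, add_assoc, ← add_smul]
      congr 2
      conv_lhs => rw [← Complex.re_add_im z]
      push_cast
      linear_combination (-(z.im * δ : ℂ)) * Complex.I_sq
    have e2 : ‖Complex.exp (((b₀ + z * ε : ℂ) • toC l) ⬝ᵥ toC y)‖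
        = Real.exp (-((b₀ + z.re * ε) * (z.im * δ) * ‖l‖ ^ 2)) *
          ‖Complex.exp ((((b₀ + z.re * ε : ℝ) : ℂ) • toC l) ⬝ᵥ toC (y + (z.im * δ) • l))‖ := by
      simp only [smul_dotProduct, toC_dot, smul_eq_mul, Complex.norm_exp, ← Real.exp_add,
        inner_add_right, inner_smul_right, real_inner_self_eq_norm_sq, Complex.re_mul_ofReal,
        Complex.add_re, Complex.ofReal_re]
      congr 1
      ring
    rw [norm_mul, e1, e2, mul_assoc, ← norm_mul, mul_assoc K]
    refine mul_le_mul ?_ (hb _ _ ?_ ?_ _) (norm_nonneg _) (Real.exp_pos _).le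
    · rw [hK, Real.exp_le_exp]
      refine (neg_le_abs _).trans ?_
      rw [abs_mul, abs_mul, abs_mul, abs_of_nonneg (sq_nonneg ‖l‖)]
      have := mul_le_mul_of_nonneg_right (habs b₀ ε)
        (by positivity : 0 ≤ |z.im| * |δ| * ‖l‖ ^ 2)
      linarith
    · rw [norm_smul, norm_mul, norm_neg, Complex.norm_I, one_mul, Complex.norm_real]
      refine le_trans ?_ (le_add_of_nonneg_right (by positivity))
      gcongr
      exact habs _ _
    · rw [norm_smul, Complex.norm_real]
      refine le_trans ?_ (le_add_of_nonneg_left (by positivity))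
      gcongr
      exact habs _ _
  refine (norm_Lp_mul_le (GaussSum.memLp_shift hG _ _) φ).trans ?_
  rw [mul_assoc]
  refine mul_le_mul_of_nonneg_left ?_ (norm_nonneg _)
  have hgt : eLpNorm (fun y => K * C * g (y + (z.im * δ) • l)) 2 volume
      = ENNReal.ofReal (K * C) * eLpNorm g 2 volume := by
    have h1 : (fun y => K * C * g (y + (z.im * δ) • l))
        = (K * C) • (g ∘ fun y => y + (z.im * δ) • l) := rfl
    rw [h1, eLpNorm_const_smul, Real.enorm_of_nonneg (by positivity),
      eLpNorm_comp_measurePreserving hgL.1 (measurePreserving_add_right volume _)]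
  have := ENNReal.toReal_mono (by rw [hgt]; exact ENNReal.mul_ne_top (by simp) hgL.2.ne)
    (eLpNorm_mono_real (p := 2) (μ := volume) hT)
  refine this.trans (le_of_eq ?_)
  rw [hgt, ENNReal.toReal_mul, ENNReal.toReal_ofReal (by positivity)]
  ring

/-- `φ` defines a functional of norm at most `N` through the pairing with
`e^{b l·y} G(y - i c l)`, `G` a sum of Gaussians. -/
def PairBound (φ : L2Rn n) (l : Rn n) (b c N : ℝ) : Prop :=
  ∀ G ∈ GaussSum n,
    ‖gaussPair φ G ((-Complex.I * c) • toC l) ((b : ℂ) • toC l)‖ ≤ N * realNorm G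

theorem realNorm_weyl {G : (Fin n → ℂ) → ℂ} (hG : G ∈ GaussSum n) (l : Rn n) (s t : ℝ) :
    realNorm (fun Z => Complex.exp (((Complex.I * s) • toC l) ⬝ᵥ Z) * G (Z + (t : ℂ) • toC l))
      = realNorm G := by
  unfold realNorm
  congr 1
  rw [← eLpNorm_comp_measurePreserving (GaussSum.memLp hG).1
    (measurePreserving_add_right volume (t • l))]
  refine eLpNorm_congr_norm_ae (Filter.Eventually.of_forall fun x => ?_)
  rw [norm_mul, Complex.norm_exp, smul_dotProduct, toC_dot, Function.comp_apply, toC_add,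
    toC_smul]
  simp

/-- Moving `z` vertically replaces `G` by a Weyl translate of the same norm. The scalar arises
because the modulation `e^{iyε l·Z}` is evaluated at `Z = x - i c l`, where its modulus is
`e^{yεc‖l‖²}`. -/
theorem PairBound.line {φ : L2Rn n} {l : Rn n} {b c N : ℝ} (h : PairBound φ l b c N)
    {G : (Fin n → ℂ) → ℂ} (hG : G ∈ GaussSum n) (ε δ y : ℝ) :
    ‖gaussPair φ G ((-Complex.I * (c + Complex.I * y * δ)) • toC l)
      ((b + Complex.I * y * ε) • toC l)‖
      ≤ Real.exp (-(y * ε * c * ‖l‖ ^ 2)) * (N * realNorm G) := by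
  have h1 := h _ (GaussSum.modulate (GaussSum.translate hG (((y * δ : ℝ) : ℂ) • toC l))
    ((Complex.I * ((y * ε : ℝ) : ℂ)) • toC l))
  rw [realNorm_weyl hG] at h1
  refine le_trans (le_of_eq ?_) (mul_le_mul_of_nonneg_left h1 (Real.exp_pos _).le)
  have e : gaussPair φ G ((-Complex.I * (c + Complex.I * y * δ)) • toC l)
      ((b + Complex.I * y * ε) • toC l) = ((Real.exp (-(y * ε * c * ‖l‖ ^ 2)) : ℝ) : ℂ) *
      gaussPair φ (fun Z => Complex.exp (((Complex.I * ((y * ε : ℝ) : ℂ)) • toC l) ⬝ᵥ Z) *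
        G (Z + ((y * δ : ℝ) : ℂ) • toC l)) ((-Complex.I * c) • toC l) ((b : ℂ) • toC l) := by
    unfold gaussPair
    rw [← integral_const_mul]
    refine integral_congr_ae (Filter.Eventually.of_forall fun x => ?_)
    dsimp only
    rw [mul_left_comm (_ : ℂ) (φ x), ← mul_assoc (Complex.exp _) (Complex.exp _),
      ← Complex.exp_add, ← mul_assoc (((Real.exp _ : ℝ) : ℂ)), Complex.ofReal_exp,
      ← Complex.exp_add]
    congr 3
    · simp only [dotProduct_add, smul_dotProduct, dotProduct_smul, toC_dot, smul_eq_mul,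
        real_inner_self_eq_norm_sq]
      push_cast
      linear_combination (y * ε * c * ‖l‖ ^ 2 : ℂ) * Complex.I_sq
    · rw [add_assoc, ← add_smul]
      congr 2
      push_cast
      linear_combination (-(y * δ : ℂ)) * Complex.I_sq
  rw [e, norm_mul, Complex.norm_real, Real.norm_of_nonneg (Real.exp_pos _).le]

theorem PairBound.interpolate {φ : L2Rn n} {l : Rn n} {b₀ c₀ b₁ c₁ N₀ N₁ s : ℝ}
    (hN₀ : 0 ≤ N₀) (hN₁ : 0 ≤ N₁) (h₀ : PairBound φ l b₀ c₀ N₀) (h₁ : PairBound φ l b₁ c₁ N₁)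
    (hs₀ : 0 ≤ s) (hs₁ : s ≤ 1) :
    PairBound φ l ((1 - s) * b₀ + s * b₁) ((1 - s) * c₀ + s * c₁)
      (N₀ ^ (1 - s) * N₁ ^ s) := by
  intro G hG
  set ε := b₁ - b₀ with hε
  set δ := c₁ - c₀ with hδ
  set M := ‖l‖ ^ 2 with hM
  -- Chosen so that `Re γ(z) = M ε (c₀ + δ Re z) Im z`: this cancels the scalar of `PairBound.line`
  -- on both boundary lines and vanishes at the real point `z = s`.
  set γ : ℂ → ℂ := fun z => -Complex.I * M * (ε * c₀ * z + ε * δ * z ^ 2 / 2) with hγ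
  set P : ℂ → ℂ := fun z =>
    gaussPair φ G ((-Complex.I * (c₀ + z * δ)) • toC l) ((b₀ + z * ε : ℂ) • toC l) with hP
  have hγre : ∀ z : ℂ, (γ z).re = M * ε * (c₀ + z.re * δ) * z.im := fun z => by
    simp only [hγ, pow_two, Complex.mul_re, Complex.mul_im, Complex.neg_re, Complex.neg_im,
      Complex.I_re, Complex.I_im, Complex.ofReal_re, Complex.ofReal_im, Complex.add_re,
      Complex.add_im, Complex.div_ofNat_re, Complex.div_ofNat_im]
    ring
  have hPd : Differentiable ℂ P := by
    convert differentiable_gaussPair φ hG ((-Complex.I * c₀) • toC l) ((-Complex.I * δ) • toC l)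
      ((b₀ : ℂ) • toC l) ((ε : ℂ) • toC l) using 2 with z
    simp only [hP]
    congr 1
    · rw [smul_smul, ← add_smul]; congr 1; ring
    · rw [smul_smul, ← add_smul]
  obtain ⟨C, k, hC, hk, hgrow⟩ := norm_gaussPair_le φ hG l b₀ c₀ ε δ
  set k' := M * |ε| * (|c₀| + |δ|) + k with hk'
  have hk'0 : 0 ≤ k' := by positivity
  have hF : ∀ z : ℂ, 0 ≤ z.re → z.re ≤ 1 →
      ‖Complex.exp (γ z) * P z‖ ≤ C * Real.exp (k' * |z.im|) := fun z h0 h1 => by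
    rw [norm_mul, Complex.norm_exp, hγre]
    have hle : M * ε * (c₀ + z.re * δ) * z.im ≤ M * |ε| * (|c₀| + |δ|) * |z.im| := by
      refine (le_abs_self _).trans ?_
      rw [abs_mul, abs_mul, abs_mul, abs_of_nonneg (sq_nonneg ‖l‖ : 0 ≤ M)]
      gcongr
      refine (abs_add_le _ _).trans ?_
      rw [abs_mul, abs_of_nonneg h0]
      have := abs_nonneg δ
      nlinarith
    calc Real.exp (M * ε * (c₀ + z.re * δ) * z.im) * ‖P z‖
        ≤ Real.exp (M * |ε| * (|c₀| + |δ|) * |z.im|) * (C * Real.exp (k * |z.im|)) := by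
          gcongr
          exact hgrow z h0 h1
      _ = C * Real.exp (k' * |z.im|) := by
          rw [hk', add_mul, Real.exp_add]; ring
  have hpolyre : ∀ (η : ℝ) (z : ℂ), ((η : ℂ) * (z * (z - 1))).re
      = η * (z.re * (z.re - 1) - z.im ^ 2) := fun η z => by
    simp only [Complex.mul_re, Complex.mul_im, Complex.ofReal_re, Complex.ofReal_im,
      Complex.sub_re, Complex.sub_im, Complex.one_re, Complex.one_im]
    ring
  have hbdry : ∀ (b c N : ℝ), 0 ≤ N → PairBound φ l b c N → ∀ z : ℂ, c₀ + z.re * δ = c →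
      b₀ + z.re * ε = b → ‖Complex.exp (γ z) * P z‖ ≤ N * realNorm G := by
    intro b c N hN h z hc hb
    have hl := h.line hG ε δ z.im
    have e : P z = gaussPair φ G ((-Complex.I * (c + Complex.I * z.im * δ)) • toC l)
      ((b + Complex.I * z.im * ε) • toC l) := by
      simp only [hP, ← hc, ← hb]
      congr 2
      · conv_lhs => rw [← Complex.re_add_im z]
        push_cast; ring
      · conv_lhs => rw [← Complex.re_add_im z]
        push_cast; ring
    rw [← e] at hl
    rw [norm_mul, Complex.norm_exp, hγre, hc]
    calc Real.exp (M * ε * c * z.im) * ‖P z‖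
        ≤ Real.exp (M * ε * c * z.im) *
          (Real.exp (-(z.im * ε * c * ‖l‖ ^ 2)) * (N * realNorm G)) := by gcongr
      _ = N * realNorm G := by
          rw [← mul_assoc, ← Real.exp_add]
          have : M * ε * c * z.im + -(z.im * ε * c * ‖l‖ ^ 2) = 0 := by rw [hM]; ring
          rw [this, Real.exp_zero, one_mul]
  -- The factor `e^{ηz(z-1)}` decays like a Gaussian in `Im z` on the strip, which gives the
  -- boundedness that the three lines theorem requires. It has modulus at most `1` on the boundary
  -- and tends to `1` at `s` as `η → 0`.
  have key : ∀ η : ℝ, 0 < η → Real.exp (η * (s * (s - 1))) * ‖P s‖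
      ≤ (N₀ * realNorm G) ^ (1 - s) * (N₁ * realNorm G) ^ s := by
    intro η hη
    have hsm : ∀ z : ℂ, 0 ≤ z.re → z.re ≤ 1 → η * (z.re * (z.re - 1) - z.im ^ 2)
        ≤ -(η * z.im ^ 2) := fun z h0 h1 => by
      nlinarith [mul_nonneg hη.le (mul_nonneg h0 (sub_nonneg.2 h1))]
    have H := Complex.HadamardThreeLines.norm_le_interp_of_mem_verticalClosedStrip₀₁'
      (fun z => Complex.exp ((η : ℂ) * (z * (z - 1))) * (Complex.exp (γ z) * P z))
      (z := (s : ℂ)) (a := N₀ * realNorm G) (b := N₁ * realNorm G) ⟨by simpa, by simpa⟩ ?_ ?_ ?_ ?_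
    · rw [norm_mul, norm_mul, Complex.norm_exp, Complex.norm_exp, hpolyre, hγre] at H
      simpa using H
    · refine Differentiable.diffContOnCl ?_
      have : Differentiable ℂ γ := by simp only [hγ]; fun_prop
      fun_prop
    · refine ⟨C * Real.exp (k' ^ 2 / (4 * η)), ?_⟩
      rintro _ ⟨z, ⟨h0, h1⟩, rfl⟩
      rw [Function.comp_apply, norm_mul, Complex.norm_exp, hpolyre]
      calc _ ≤ Real.exp (-(η * z.im ^ 2)) * (C * Real.exp (k' * |z.im|)) := by
            gcongr
            · exact hsm z h0 h1
            · exact hF z h0 h1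
        _ = C * Real.exp (-(η * z.im ^ 2) + k' * |z.im|) := by rw [Real.exp_add]; ring
        _ ≤ _ := by
            gcongr
            rw [← sq_abs z.im]
            have : 0 ≤ (k' - 2 * η * |z.im|) ^ 2 / (4 * η) := by positivity
            have e : (k' - 2 * η * |z.im|) ^ 2 / (4 * η)
                = k' ^ 2 / (4 * η) - k' * |z.im| + η * |z.im| ^ 2 := by
              field_simp; ring
            linarith
    · intro z hz
      have hz' : z.re = 0 := hz
      rw [norm_mul, Complex.norm_exp, hpolyre]
      have h1 := hsm z hz'.ge (hz'.le.trans zero_le_one)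
      have h2 : Real.exp (η * (z.re * (z.re - 1) - z.im ^ 2)) ≤ 1 :=
        Real.exp_le_one_iff.2 (h1.trans (by simp; positivity))
      exact (mul_le_of_le_one_left (norm_nonneg _) h2).trans
        (hbdry b₀ c₀ N₀ hN₀ h₀ z (by simp [hz']) (by simp [hz']))
    · intro z hz
      have hz' : z.re = 1 := hz
      rw [norm_mul, Complex.norm_exp, hpolyre]
      have h1 := hsm z (by simp [hz']) hz'.le
      have h2 : Real.exp (η * (z.re * (z.re - 1) - z.im ^ 2)) ≤ 1 :=
        Real.exp_le_one_iff.2 (h1.trans (by simp; positivity))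
      exact (mul_le_of_le_one_left (norm_nonneg _) h2).trans
        (hbdry b₁ c₁ N₁ hN₁ h₁ z (by simp [hz', hδ]) (by simp [hz', hε]))
  have hlim : ‖P s‖ ≤ (N₀ * realNorm G) ^ (1 - s) * (N₁ * realNorm G) ^ s := by
    have ht : Filter.Tendsto (fun η : ℝ => Real.exp (η * (s * (s - 1))) * ‖P s‖)
        (nhdsWithin 0 (Set.Ioi 0)) (nhds ‖P s‖) := by
      have hc : Continuous fun η : ℝ => Real.exp (η * (s * (s - 1))) * ‖P s‖ := by fun_prop
      have := hc.tendsto 0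
      simp only [zero_mul, Real.exp_zero, one_mul] at this
      exact this.mono_left nhdsWithin_le_nhds
    exact le_of_tendsto ht (eventually_nhdsWithin_of_forall key)
  have e : gaussPair φ G ((-Complex.I * ((1 - s) * c₀ + s * c₁ : ℝ)) • toC l)
      ((((1 - s) * b₀ + s * b₁ : ℝ) : ℂ) • toC l) = P s := by
    simp only [hP, hε, hδ]
    congr 2
    · push_cast; ring
    · push_cast; ring
  rw [e]
  refine hlim.trans (le_of_eq ?_)
  have hg := realNorm_nonneg G
  rw [Real.mul_rpow hN₀ hg, Real.mul_rpow hN₁ hg, mul_mul_mul_comm,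
    ← Real.rpow_add_of_nonneg hg (by linarith) hs₀]
  simp

end Interpolation

/-! ### Linear weights for one particle. -/

section OneParticle

open Matrix

variable {n : ℕ}

/-- The weighted norm `‖e^{a·x} f‖` in `L²(ℝⁿ)`. -/
noncomputable def expNorm (a : Rn n) (f : Rn n → ℂ) : ℝ≥0∞ :=
  eLpNorm (fun x => (Real.exp (inner ℝ a x) : ℂ) * f x) 2 volume

theorem expNorm_congr {a : Rn n} {f g : Rn n → ℂ} (h : f =ᵐ[volume] g) :
    expNorm a f = expNorm a g :=
  eLpNorm_congr_ae (by filter_upwards [h] with x hx; rw [hx])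

theorem ae_eq_zero_of_expNorm_eq_zero {a : Rn n} {f : Rn n → ℂ}
    (hf : AEStronglyMeasurable f volume) (h : expNorm a f = 0) : f =ᵐ[volume] 0 := by
  have hc : Continuous fun x : Rn n => (Real.exp (inner ℝ a x) : ℂ) := by fun_prop
  replace h := (eLpNorm_eq_zero_iff (hc.aestronglyMeasurable.mul hf) two_ne_zero).1 h
  filter_upwards [h] with x hx
  exact (mul_eq_zero.1 hx).resolve_left (by simp)

theorem fourier_freeSchrodinger (t : ℝ) (u : L2Rn n) :
    (𝓕 (freeSchrodinger t u) : L2Rn n) =ᵐ[volume]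
      fun y => schrodingerSymbol t y * (𝓕 u : L2Rn n) y := by
  rw [freeSchrodinger, fourier_fourierInv_eq]
  exact MemLp.coeFn_toLp _

theorem norm_freeSchrodinger (t : ℝ) (u : L2Rn n) : ‖freeSchrodinger t u‖ = ‖u‖ := by
  rw [← Lp.norm_fourier_eq, ← Lp.norm_fourier_eq u, Lp.norm_def, Lp.norm_def]
  congr 1
  refine eLpNorm_congr_norm_ae ?_
  filter_upwards [fourier_freeSchrodinger t u] with y hy
  rw [hy, norm_mul, norm_schrodingerSymbol, one_mul]

theorem freeSchrodinger_zero (u : L2Rn n) : freeSchrodinger 0 u = u := by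
  have : (𝓕 (freeSchrodinger 0 u) : L2Rn n) = 𝓕 u := by
    refine Lp.ext ?_
    filter_upwards [fourier_freeSchrodinger 0 u] with y hy
    rw [hy]
    simp [schrodingerSymbol]
  rw [← fourierInv_fourier_eq (E := L2Rn n) (F := L2Rn n) (freeSchrodinger 0 u), this,
    fourierInv_fourier_eq]

theorem freeSchrodinger_eq_zero {t : ℝ} {u : L2Rn n} : freeSchrodinger t u = 0 ↔ u = 0 := by
  rw [← norm_eq_zero, norm_freeSchrodinger, norm_eq_zero]

/-- The product of `G` with the chirp `e^{i t (2π)² Z·Z}`. -/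
noncomputable def chirpMul (t : ℝ) (G : (Fin n → ℂ) → ℂ) : (Fin n → ℂ) → ℂ :=
  fun Z => Complex.exp (Complex.I * (t * (2 * Real.pi) ^ 2 : ℝ) * (Z ⬝ᵥ Z)) * G Z

theorem chirpMul_mem {t : ℝ} {G : (Fin n → ℂ) → ℂ} (hG : G ∈ GaussSum n) :
    chirpMul t G ∈ GaussSum n :=
  GaussSum.chirp hG (by rw [Complex.re_mul_ofReal, Complex.I_re, zero_mul])

theorem chirpMul_neg_chirpMul (t : ℝ) (G : (Fin n → ℂ) → ℂ) :
    chirpMul t (chirpMul (-t) G) = G := by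
  ext Z
  simp only [chirpMul]
  rw [← mul_assoc, ← Complex.exp_add]
  have : Complex.I * (t * (2 * Real.pi) ^ 2 : ℝ) * (Z ⬝ᵥ Z)
      + Complex.I * (-t * (2 * Real.pi) ^ 2 : ℝ) * (Z ⬝ᵥ Z) = 0 := by
    push_cast; ring
  rw [this, Complex.exp_zero, one_mul]

theorem realNorm_chirpMul (t : ℝ) (G : (Fin n → ℂ) → ℂ) :
    realNorm (chirpMul t G) = realNorm G := by
  unfold realNorm
  congr 1
  refine eLpNorm_congr_norm_ae (Filter.Eventually.of_forall fun x => ?_)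
  rw [chirpMul, norm_mul, Complex.norm_exp, toC_dot_self, mul_assoc, ← Complex.ofReal_mul,
    Complex.re_mul_ofReal, Complex.I_re, zero_mul, Real.exp_zero, one_mul]

/-- At `y - i c l` the chirp has exponent `4π²it(|y|² - 2ic l·y - c²‖l‖²)`. Its first term cancels
the Schrödinger symbol, the second is the weight with `b = 8π²tc`, and the third is a phase. -/
theorem norm_gaussPair_fourier (t c : ℝ) (l : Rn n) (u : L2Rn n) (G : (Fin n → ℂ) → ℂ) :
    ‖gaussPair (𝓕 u) G ((-Complex.I * c) • toC l)
      (((8 * Real.pi ^ 2 * t * c : ℝ) : ℂ) • toC l)‖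
    = ‖∫ y, (𝓕 (freeSchrodinger t u) : L2Rn n) y *
        chirpMul t G (toC y + (-Complex.I) • toC (c • l))‖ := by
  have e : ∫ y, (𝓕 (freeSchrodinger t u) : L2Rn n) y *
        chirpMul t G (toC y + (-Complex.I) • toC (c • l))
      = Complex.exp (Complex.I * (-(4 * Real.pi ^ 2 * t * c ^ 2 * ‖l‖ ^ 2) : ℝ)) *
        gaussPair (𝓕 u) G ((-Complex.I * c) • toC l)
          (((8 * Real.pi ^ 2 * t * c : ℝ) : ℂ) • toC l) := by
    unfold gaussPair
    rw [← integral_const_mul]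
    refine integral_congr_ae ?_
    filter_upwards [fourier_freeSchrodinger t u] with y hy
    rw [hy, chirpMul, schrodingerSymbol, toC_smul, smul_smul]
    rw [mul_right_comm, ← mul_assoc (Complex.exp _) (Complex.exp _), ← Complex.exp_add,
      mul_left_comm (Complex.exp _) ((𝓕 u : L2Rn n) y), ← mul_assoc (Complex.exp _)
      (Complex.exp _), ← Complex.exp_add, mul_comm _ ((𝓕 u : L2Rn n) y), mul_assoc]
    congr 3
    simp only [dotProduct_add, add_dotProduct, smul_dotProduct, dotProduct_smul, toC_dot,
      smul_eq_mul, real_inner_self_eq_norm_sq, real_inner_comm l y]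
    push_cast
    linear_combination (-(8 * Real.pi ^ 2 * t * c * (inner ℝ l y : ℝ)) +
      Complex.I * (4 * Real.pi ^ 2 * t * c ^ 2 * ‖l‖ ^ 2) : ℂ) * Complex.I_sq
  rw [e, norm_mul, Complex.norm_exp, Complex.re_mul_ofReal, Complex.I_re, zero_mul, Real.exp_zero,
    one_mul]

theorem two_pi_inner_smul (C : ℝ) (l x : Rn n) :
    (2 * Real.pi * (inner ℝ ((C / (2 * Real.pi)) • l) x : ℝ) : ℂ)
      = ((inner ℝ (C • l) x : ℝ) : ℂ) := by
  have hpi : (Real.pi : ℂ) ≠ 0 := by simp [Real.pi_ne_zero]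
  rw [real_inner_smul_left, real_inner_smul_left]
  push_cast
  field_simp

theorem pairBound_of_expNorm_le {t C N : ℝ} (hN : 0 ≤ N) {l : Rn n} {u : L2Rn n}
    (h : expNorm (C • l) (freeSchrodinger t u) ≤ ENNReal.ofReal N) :
    PairBound (𝓕 u) l (4 * Real.pi * t * C) (C / (2 * Real.pi)) N := by
  intro G hG
  have hb : 4 * Real.pi * t * C = 8 * Real.pi ^ 2 * t * (C / (2 * Real.pi)) := by
    field_simp; ring
  obtain ⟨K, hK, hGK⟩ := GaussSum.exists_fourier (chirpMul_mem (t := t) hG)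
  rw [hb, norm_gaussPair_fourier, hGK.integral_eq (chirpMul_mem hG) hK]
  simp only [two_pi_inner_smul]
  have hv : MemLp (fun x => (Real.exp (inner ℝ (C • l) x) : ℂ) * freeSchrodinger t u x) 2
      volume := by
    have hc : Continuous fun x : Rn n => (Real.exp (inner ℝ (C • l) x) : ℂ) := by fun_prop
    exact ⟨hc.aestronglyMeasurable.mul (Lp.aestronglyMeasurable _),
      h.trans_lt ENNReal.ofReal_lt_top⟩
  have h1 := norm_integral_mul_le hv (GaussSum.memLp hK)
  simp only [Complex.ofReal_exp] at h1
  simp only [mul_left_comm ((freeSchrodinger t u) _), ← mul_assoc]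
  refine h1.trans ?_
  rw [← realNorm_chirpMul t G, hGK.realNorm_eq (chirpMul_mem hG) hK]
  refine mul_le_mul_of_nonneg_right ?_ (realNorm_nonneg K)
  have h2 := ENNReal.toReal_mono ENNReal.ofReal_ne_top h
  rw [ENNReal.toReal_ofReal hN] at h2
  simpa only [expNorm, Complex.ofReal_exp] using h2

theorem expNorm_le_of_pairBound {t C N : ℝ} (hN : 0 ≤ N) {l : Rn n} {u : L2Rn n}
    (h : PairBound (𝓕 u) l (4 * Real.pi * t * C) (C / (2 * Real.pi)) N) :
    expNorm (C • l) (freeSchrodinger t u) ≤ ENNReal.ofReal N := by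
  have hb : 4 * Real.pi * t * C = 8 * Real.pi ^ 2 * t * (C / (2 * Real.pi)) := by
    field_simp; ring
  have := eLpNorm_le_of_forall_gaussSum hN ((C / (2 * Real.pi)) • l) (freeSchrodinger t u) ?_
  · simpa only [expNorm, two_pi_inner_smul, Complex.ofReal_exp] using this
  · intro K hK
    obtain ⟨H, hH, hHK⟩ := GaussSum.exists_fourierInv hK
    -- The opposite chirp cancels the one produced by the evolution, so the pairing is with `H`
    -- itself, whose transform is the given `K`.
    have h1 := h _ (chirpMul_mem (t := -t) hH)
    rw [hb, norm_gaussPair_fourier, chirpMul_neg_chirpMul, hHK.integral_eq hH hK,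
      realNorm_chirpMul, hHK.realNorm_eq hH hK] at h1
    exact h1

theorem pairBound_of_expNorm_fourier_le {b N : ℝ} (hN : 0 ≤ N) {l : Rn n} {u : L2Rn n}
    (h : expNorm (b • l) (𝓕 u : L2Rn n) ≤ ENNReal.ofReal N) :
    PairBound (𝓕 u) l b 0 N := by
  intro G hG
  have hv : MemLp (fun x => (Real.exp (inner ℝ (b • l) x) : ℂ) * (𝓕 u : L2Rn n) x) 2
      volume := by
    have hc : Continuous fun x : Rn n => (Real.exp (inner ℝ (b • l) x) : ℂ) := by fun_prop
    exact ⟨hc.aestronglyMeasurable.mul (Lp.aestronglyMeasurable _),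
      h.trans_lt ENNReal.ofReal_lt_top⟩
  have h1 := norm_integral_mul_le hv (GaussSum.memLp hG)
  have e : gaussPair (𝓕 u) G ((-Complex.I * (0 : ℝ)) • toC l) ((b : ℂ) • toC l)
      = ∫ x, (Real.exp (inner ℝ (b • l) x) : ℂ) * (𝓕 u : L2Rn n) x * G (toC x) := by
    unfold gaussPair
    refine integral_congr_ae (Filter.Eventually.of_forall fun x => ?_)
    simp only [Complex.ofReal_zero, mul_zero, zero_smul, add_zero, ← toC_smul, toC_dot,
      Complex.ofReal_exp]
    ring
  rw [e]
  refine h1.trans (mul_le_mul_of_nonneg_right ?_ (realNorm_nonneg G))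
  have h2 := ENNReal.toReal_mono ENNReal.ofReal_ne_top h
  rwa [ENNReal.toReal_ofReal hN] at h2

/-- `A ∈ [0,∞]` bounds the functionals that `𝓕 u` defines through the pairing with
`e^{b l·y} G(y - i c l)`, and vanishes for `u = 0` only. -/
def EndpointBound (u : L2Rn n) (l : Rn n) (b c : ℝ) (A : ℝ≥0∞) : Prop :=
  (A = 0 → u = 0) ∧ ∀ N : ℝ, 0 ≤ N → A ≤ ENNReal.ofReal N → PairBound (𝓕 u) l b c N

theorem endpointBound_freeSchrodinger (t C : ℝ) (l : Rn n) (u : L2Rn n) :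
    EndpointBound u l (4 * Real.pi * t * C) (C / (2 * Real.pi))
      (expNorm (C • l) (freeSchrodinger t u)) := by
  refine ⟨fun h => ?_, fun N hN h => pairBound_of_expNorm_le hN h⟩
  rw [← freeSchrodinger_eq_zero (t := t), Lp.eq_zero_iff_ae_eq_zero]
  exact ae_eq_zero_of_expNorm_eq_zero (Lp.aestronglyMeasurable _) h

theorem endpointBound_fourier (b : ℝ) (l : Rn n) (u : L2Rn n) :
    EndpointBound u l b 0 (expNorm (b • l) (𝓕 u : L2Rn n)) := by
  refine ⟨fun h => ?_, fun N hN h => pairBound_of_expNorm_fourier_le hN h⟩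
  rw [← norm_eq_zero, ← Lp.norm_fourier_eq, norm_eq_zero, Lp.eq_zero_iff_ae_eq_zero]
  exact ae_eq_zero_of_expNorm_eq_zero (Lp.aestronglyMeasurable _) h

theorem expNorm_freeSchrodinger_zero (a : Rn n) (t : ℝ) :
    expNorm a (freeSchrodinger t (0 : L2Rn n)) = 0 := by
  rw [freeSchrodinger_eq_zero.2 rfl, expNorm_congr (Lp.coeFn_zero ℂ 2 volume)]
  simp [expNorm]

/-- Interpolation with values in `[0,∞]`. The hypotheses `hb` and `hc` say that the target point
divides the segment between the endpoints in the ratio given by `θ`. -/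
theorem expNorm_le_of_endpointBound {u : L2Rn n} {l : Rn n} {t C b₀ c₀ b₁ c₁ θ : ℝ}
    {A₀ A₁ : ℝ≥0∞} (h₀ : EndpointBound u l b₀ c₀ A₀) (h₁ : EndpointBound u l b₁ c₁ A₁)
    (hθ₀ : 0 ≤ θ) (hθ₁ : θ ≤ 1)
    (hb : 4 * Real.pi * t * C = θ * b₀ + (1 - θ) * b₁)
    (hc : C / (2 * Real.pi) = θ * c₀ + (1 - θ) * c₁) :
    expNorm (C • l) (freeSchrodinger t u) ≤ A₀ ^ θ * A₁ ^ (1 - θ) := by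
  -- As `0 · ∞ = 0`, the right-hand side can vanish although the other factor is infinite; a
  -- vanishing endpoint forces `u = 0`.
  rcases eq_or_ne A₀ 0 with hA₀ | hA₀
  · rw [h₀.1 hA₀, expNorm_freeSchrodinger_zero]
    exact zero_le
  rcases eq_or_ne A₁ 0 with hA₁ | hA₁
  · rw [h₁.1 hA₁, expNorm_freeSchrodinger_zero]
    exact zero_le
  have pos : ∀ {A : ℝ≥0∞} {x : ℝ}, 0 ≤ x → A ≠ 0 → A ^ x ≠ 0 := fun hx hA => by
    simp [ENNReal.rpow_eq_zero_iff, hA, hx.not_gt]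
  -- For `θ = 0` or `θ = 1` one factor is a zeroth power, equal to `1` even if its base is infinite,
  -- so the bound must come from the other endpoint alone.
  rcases eq_or_lt_of_le hθ₀ with rfl | hθ₀'
  · simp only [zero_mul, sub_zero, one_mul, zero_add] at hb hc
    simp only [ENNReal.rpow_zero, sub_zero, ENNReal.rpow_one, one_mul]
    rcases eq_or_ne A₁ ⊤ with rfl | hT
    · exact le_top
    · rw [← ENNReal.ofReal_toReal hT]
      refine expNorm_le_of_pairBound ENNReal.toReal_nonneg ?_
      rw [hb, hc]
      exact h₁.2 _ ENNReal.toReal_nonneg (ENNReal.ofReal_toReal hT).ge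
  rcases eq_or_lt_of_le hθ₁ with rfl | hθ₁'
  · simp only [sub_self, zero_mul, one_mul, add_zero] at hb hc
    simp only [ENNReal.rpow_zero, sub_self, ENNReal.rpow_one, mul_one]
    rcases eq_or_ne A₀ ⊤ with rfl | hT
    · exact le_top
    · rw [← ENNReal.ofReal_toReal hT]
      refine expNorm_le_of_pairBound ENNReal.toReal_nonneg ?_
      rw [hb, hc]
      exact h₀.2 _ ENNReal.toReal_nonneg (ENNReal.ofReal_toReal hT).ge
  rcases eq_or_ne A₀ ⊤ with rfl | hT₀
  · rw [ENNReal.top_rpow_of_pos hθ₀', ENNReal.top_mul (pos (sub_nonneg.2 hθ₁) hA₁)]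
    exact le_top
  rcases eq_or_ne A₁ ⊤ with rfl | hT₁
  · rw [ENNReal.top_rpow_of_pos (sub_pos.2 hθ₁'), ENNReal.mul_top (pos hθ₀ hA₀)]
    exact le_top
  have H := (h₀.2 _ ENNReal.toReal_nonneg (ENNReal.ofReal_toReal hT₀).ge).interpolate
    ENNReal.toReal_nonneg ENNReal.toReal_nonneg
    (h₁.2 _ ENNReal.toReal_nonneg (ENNReal.ofReal_toReal hT₁).ge) (s := 1 - θ)
    (sub_nonneg.2 hθ₁) (by linarith)
  rw [sub_sub_cancel, ← hb, ← hc] at H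
  refine (expNorm_le_of_pairBound (by positivity) H).trans (le_of_eq ?_)
  rw [ENNReal.ofReal_mul (by positivity), ← ENNReal.ofReal_rpow_of_nonneg ENNReal.toReal_nonneg hθ₀,
    ← ENNReal.ofReal_rpow_of_nonneg ENNReal.toReal_nonneg (sub_nonneg.2 hθ₁),
    ENNReal.ofReal_toReal hT₀, ENNReal.ofReal_toReal hT₁]

end OneParticle

/-! ### Two particles: factorization of linear weights and Gaussian averaging. -/

section TwoParticles

variable {n : ℕ}

theorem eLpNorm_two_sq {α : Type*} [MeasurableSpace α] (μ : Measure α) (f : α → ℂ) :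
    eLpNorm f 2 μ ^ 2 = ∫⁻ x, ‖f x‖ₑ ^ 2 ∂μ := by
  have := eLpNorm_nnreal_pow_eq_lintegral (p := 2) (f := f) (μ := μ) two_ne_zero
  simpa using! this

theorem interactionNorm_sq (w : Rn n → ℝ) (f g : Rn n → ℂ) :
    interactionNorm w f g ^ 2 = ∫⁻ p : Rn n × Rn n,
      ENNReal.ofReal (Real.exp (2 * w (p.1 - p.2))) * (‖f p.1‖ₑ ^ 2 * ‖g p.2‖ₑ ^ 2)
        ∂((volume : Measure (Rn n)).prod volume) := by
  rw [interactionNorm, eLpNorm_two_sq]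
  refine lintegral_congr fun p => ?_
  have e : ‖(Real.exp (w (p.1 - p.2)) : ℂ)‖ₑ ^ 2
      = ENNReal.ofReal (Real.exp (2 * w (p.1 - p.2))) := by
    rw [← ofReal_norm, Complex.norm_real, Real.norm_of_nonneg (Real.exp_pos _).le,
      ← ENNReal.ofReal_pow (Real.exp_pos _).le, ← Real.exp_nat_mul]
    norm_num
  rw [enorm_mul, enorm_mul, mul_pow, mul_pow, e]

theorem expNorm_sq (a : Rn n) (f : Rn n → ℂ) :
    expNorm a f ^ 2 = ∫⁻ x, ENNReal.ofReal (Real.exp (2 * inner ℝ a x)) * ‖f x‖ₑ ^ 2 := by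
  rw [expNorm, eLpNorm_two_sq]
  refine lintegral_congr fun x => ?_
  have e : ‖(Real.exp (inner ℝ a x) : ℂ)‖ₑ ^ 2
      = ENNReal.ofReal (Real.exp (2 * inner ℝ a x)) := by
    rw [← ofReal_norm, Complex.norm_real, Real.norm_of_nonneg (Real.exp_pos _).le,
      ← ENNReal.ofReal_pow (Real.exp_pos _).le, ← Real.exp_nat_mul]
    norm_num
  rw [enorm_mul, mul_pow, e]

theorem interactionNorm_linear {f g : Rn n → ℂ} (hf : AEStronglyMeasurable f volume)
    (hg : AEStronglyMeasurable g volume) (k : ℝ) (l : Rn n) :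
    interactionNorm (fun z => k * inner ℝ l z) f g = expNorm (k • l) f * expNorm (k • -l) g := by
  refine (ENNReal.pow_right_strictMono two_ne_zero).injective ?_
  simp only [mul_pow]
  rw [interactionNorm_sq, expNorm_sq, expNorm_sq]
  have hm : ∀ a : Rn n, Measurable fun x : Rn n => ENNReal.ofReal (Real.exp (2 * inner ℝ a x)) :=
    fun a => by fun_prop
  refine Eq.trans (lintegral_congr fun p => ?_) (lintegral_prod_mul
    ((hm (k • l)).aemeasurable.mul (hf.enorm.pow_const 2))
    ((hm (k • -l)).aemeasurable.mul (hg.enorm.pow_const 2)))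
  rw [mul_mul_mul_comm, ← ENNReal.ofReal_mul (Real.exp_pos _).le, ← Real.exp_add]
  congr 3
  simp only [real_inner_smul_left, inner_sub_right, inner_neg_left]
  ring

/-- The total mass of the Gaussian `e^{-|l|²/2}`. -/
noncomputable def gaussMass (n : ℕ) : ℝ≥0∞ :=
  ∫⁻ l : Rn n, ENNReal.ofReal (Real.exp (-‖l‖ ^ 2 / 2))

theorem gaussMass_ne_top : gaussMass n ≠ ⊤ := by
  have h := (integrable_gaussian (n := n) (r := 1 / 2) (by norm_num)).lintegral_lt_top
  refine ne_of_lt (lt_of_eq_of_lt (lintegral_congr fun l => ?_) h)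
  congr 2
  ring

theorem gaussMass_ne_zero : gaussMass n ≠ 0 := by
  intro h
  rw [gaussMass, lintegral_eq_zero_iff (by fun_prop)] at h
  obtain ⟨l, hl⟩ := h.exists
  simp only [Pi.zero_apply, ENNReal.ofReal_eq_zero] at hl
  exact absurd hl (Real.exp_pos _).not_ge

/-- Completing the square: `-‖l‖²/2 + 2k l·z = -‖l - 2kz‖²/2 + 2k²‖z‖²`, and the mass is translation
invariant. -/
theorem lintegral_gaussian_mul_exp (k : ℝ) (z : Rn n) :
    ∫⁻ l : Rn n, ENNReal.ofReal (Real.exp (-‖l‖ ^ 2 / 2)) *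
        ENNReal.ofReal (Real.exp (2 * (k * inner ℝ l z)))
      = gaussMass n * ENNReal.ofReal (Real.exp (2 * (k ^ 2 * ‖z‖ ^ 2))) := by
  rw [gaussMass, ← lintegral_sub_right_eq_self (μ := (volume : Measure (Rn n)))
    (fun l => ENNReal.ofReal (Real.exp (-‖l‖ ^ 2 / 2))) ((2 * k) • z),
    ← lintegral_mul_const' _ _ ENNReal.ofReal_ne_top]
  refine lintegral_congr fun l => ?_
  rw [← ENNReal.ofReal_mul (Real.exp_pos _).le, ← ENNReal.ofReal_mul (Real.exp_pos _).le,
    ← Real.exp_add, ← Real.exp_add, norm_sub_sq_real, norm_smul, inner_smul_right, mul_pow,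
    Real.norm_eq_abs, sq_abs]
  congr 2
  ring

theorem aemeasurable_gaussian_interaction {f g : Rn n → ℂ} (hf : AEStronglyMeasurable f volume)
    (hg : AEStronglyMeasurable g volume) (k : ℝ) :
    AEMeasurable (fun q : Rn n × (Rn n × Rn n) => ENNReal.ofReal (Real.exp (-‖q.1‖ ^ 2 / 2)) *
        (ENNReal.ofReal (Real.exp (2 * (k * inner ℝ q.1 (q.2.1 - q.2.2)))) *
          (‖f q.2.1‖ₑ ^ 2 * ‖g q.2.2‖ₑ ^ 2)))
      ((volume : Measure (Rn n)).prod ((volume : Measure (Rn n)).prod volume)) := by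
  have h1 : AEMeasurable (fun p : Rn n × Rn n => ‖f p.1‖ₑ ^ 2 * ‖g p.2‖ₑ ^ 2)
      ((volume : Measure (Rn n)).prod volume) :=
    (hf.comp_fst.enorm.pow_const 2).mul (hg.comp_snd.enorm.pow_const 2)
  have h2 := h1.comp_snd (μ := (volume : Measure (Rn n)))
  have h3 : Measurable fun q : Rn n × (Rn n × Rn n) =>
      ENNReal.ofReal (Real.exp (-‖q.1‖ ^ 2 / 2)) := by fun_prop
  have h4 : Measurable fun q : Rn n × (Rn n × Rn n) =>
      ENNReal.ofReal (Real.exp (2 * (k * inner ℝ q.1 (q.2.1 - q.2.2)))) := by fun_prop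
  exact h3.aemeasurable.mul (h4.aemeasurable.mul h2)

theorem gaussian_mul_interactionNorm_sq (f g : Rn n → ℂ) (k : ℝ) (l : Rn n) :
    ENNReal.ofReal (Real.exp (-‖l‖ ^ 2 / 2)) *
        interactionNorm (fun z => k * inner ℝ l z) f g ^ 2
      = ∫⁻ p, ENNReal.ofReal (Real.exp (-‖l‖ ^ 2 / 2)) *
        (ENNReal.ofReal (Real.exp (2 * (k * inner ℝ l (p.1 - p.2)))) *
          (‖f p.1‖ₑ ^ 2 * ‖g p.2‖ₑ ^ 2)) ∂((volume : Measure (Rn n)).prod volume) := by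
  rw [interactionNorm_sq, lintegral_const_mul' _ _ ENNReal.ofReal_ne_top]

theorem aemeasurable_gaussian_mul_interactionNorm_sq {f g : Rn n → ℂ}
    (hf : AEStronglyMeasurable f volume) (hg : AEStronglyMeasurable g volume) (k : ℝ) :
    AEMeasurable fun l : Rn n => ENNReal.ofReal (Real.exp (-‖l‖ ^ 2 / 2)) *
      interactionNorm (fun z => k * inner ℝ l z) f g ^ 2 := by
  simp only [gaussian_mul_interactionNorm_sq]
  exact (aemeasurable_gaussian_interaction hf hg k).lintegral_prod_right'

/-- Gaussian averages of linear weights are quadratic weights. -/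
theorem lintegral_gaussian_mul_interactionNorm_sq {f g : Rn n → ℂ}
    (hf : AEStronglyMeasurable f volume) (hg : AEStronglyMeasurable g volume) (k : ℝ) :
    ∫⁻ l : Rn n, ENNReal.ofReal (Real.exp (-‖l‖ ^ 2 / 2)) *
        interactionNorm (fun z => k * inner ℝ l z) f g ^ 2
      = gaussMass n * interactionNorm (fun z => k ^ 2 * ‖z‖ ^ 2) f g ^ 2 := by
  simp only [gaussian_mul_interactionNorm_sq]
  rw [lintegral_lintegral_swap (aemeasurable_gaussian_interaction hf hg k), interactionNorm_sq,
    ← lintegral_const_mul' _ _ gaussMass_ne_top]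
  refine lintegral_congr fun p => ?_
  simp only [← mul_assoc _ _ (‖f p.1‖ₑ ^ 2 * ‖g p.2‖ₑ ^ 2)]
  rw [lintegral_mul_const _ (by fun_prop), lintegral_gaussian_mul_exp]

/-- The square of the linear inequality is integrated against the Gaussian in `l`, and Hölder's
inequality with exponents `θ` and `1 - θ` separates the two factors. -/
theorem interactionNorm_quadratic_le {f g f₀ g₀ f₁ g₁ : Rn n → ℂ}
    (hf : AEStronglyMeasurable f volume) (hg : AEStronglyMeasurable g volume)
    (hf₀ : AEStronglyMeasurable f₀ volume) (hg₀ : AEStronglyMeasurable g₀ volume)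
    (hf₁ : AEStronglyMeasurable f₁ volume) (hg₁ : AEStronglyMeasurable g₁ volume)
    {k k₀ k₁ θ : ℝ} (hθ₀ : 0 ≤ θ) (hθ₁ : θ ≤ 1)
    (h : ∀ l : Rn n, interactionNorm (fun z => k * inner ℝ l z) f g
      ≤ interactionNorm (fun z => k₀ * inner ℝ l z) f₀ g₀ ^ θ *
        interactionNorm (fun z => k₁ * inner ℝ l z) f₁ g₁ ^ (1 - θ)) :
    interactionNorm (fun z => k ^ 2 * ‖z‖ ^ 2) f g
      ≤ interactionNorm (fun z => k₀ ^ 2 * ‖z‖ ^ 2) f₀ g₀ ^ θ *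
        interactionNorm (fun z => k₁ ^ 2 * ‖z‖ ^ 2) f₁ g₁ ^ (1 - θ) := by
  have hθ' := sub_nonneg.2 hθ₁
  -- Since the exponents add up to `1`, a constant distributes over the two factors. This is used
  -- for the Gaussian density before Hölder and for its total mass after it.
  have split : ∀ c A B : ℝ≥0∞, c ≠ 0 → c ≠ ⊤ →
      c * (A ^ θ * B ^ (1 - θ)) ^ 2 = (c * A ^ 2) ^ θ * (c * B ^ 2) ^ (1 - θ) := by
    intro c A B h0 hT
    have sw : ∀ (A : ℝ≥0∞) (x : ℝ), (A ^ x) ^ 2 = (A ^ 2) ^ x := fun A x => by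
      rw [← ENNReal.rpow_natCast, ← ENNReal.rpow_natCast, ← ENNReal.rpow_mul,
        ← ENNReal.rpow_mul, mul_comm]
    rw [ENNReal.mul_rpow_of_nonneg _ _ hθ₀, ENNReal.mul_rpow_of_nonneg _ _ hθ', mul_mul_mul_comm,
      ← ENNReal.rpow_add _ _ h0 hT, mul_pow, sw, sw]
    simp
  have key : gaussMass n * interactionNorm (fun z => k ^ 2 * ‖z‖ ^ 2) f g ^ 2
      ≤ gaussMass n * (interactionNorm (fun z => k₀ ^ 2 * ‖z‖ ^ 2) f₀ g₀ ^ θ *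
        interactionNorm (fun z => k₁ ^ 2 * ‖z‖ ^ 2) f₁ g₁ ^ (1 - θ)) ^ 2 := by
    rw [split _ _ _ gaussMass_ne_zero gaussMass_ne_top,
      ← lintegral_gaussian_mul_interactionNorm_sq hf hg,
      ← lintegral_gaussian_mul_interactionNorm_sq hf₀ hg₀,
      ← lintegral_gaussian_mul_interactionNorm_sq hf₁ hg₁]
    refine (lintegral_mono fun l => ?_).trans (ENNReal.lintegral_mul_norm_pow_le
      (aemeasurable_gaussian_mul_interactionNorm_sq hf₀ hg₀ k₀)
      (aemeasurable_gaussian_mul_interactionNorm_sq hf₁ hg₁ k₁) hθ₀ hθ' (by ring))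
    rw [← split _ _ _ (by simp [Real.exp_pos]) ENNReal.ofReal_ne_top]
    gcongr
    exact h l
  rw [ENNReal.mul_le_mul_iff_right gaussMass_ne_zero gaussMass_ne_top] at key
  exact (ENNReal.pow_right_strictMono two_ne_zero).le_iff_le.1 key

theorem quasiMeasurePreserving_smul {c : ℝ} (hc : c ≠ 0) :
    Measure.QuasiMeasurePreserving (fun ξ : Rn n => c • ξ) volume volume := by
  refine ⟨measurable_const_smul c, ?_⟩
  rw [Measure.map_addHaar_smul _ hc]
  exact Measure.smul_absolutelyContinuous

theorem aestronglyMeasurable_unitaryFourier (u : L2Rn n) :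
    AEStronglyMeasurable (unitaryFourier u) volume :=
  ((Lp.aestronglyMeasurable (𝓕 u : L2Rn n)).comp_quasiMeasurePreserving
    (quasiMeasurePreserving_smul (by positivity))).const_mul _

/-- Under `ξ = 2πζ` the Jacobian `(2π)^n` cancels the squared normalization, and the weight
parameter is multiplied by `2π`. -/
theorem expNorm_unitaryFourier (k : ℝ) (l : Rn n) (u : L2Rn n) :
    expNorm (k • l) (unitaryFourier u) = expNorm ((2 * Real.pi * k) • l) (𝓕 u : L2Rn n) := by
  refine (ENNReal.pow_right_strictMono two_ne_zero).injective ?_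
  rw [expNorm_sq, expNorm_sq]
  set c : ℝ := (2 * Real.pi)⁻¹ with hc
  have hc0 : 0 < c := by positivity
  have hemb : MeasurableEmbedding fun ξ : Rn n => c • ξ :=
    (Homeomorph.smulOfNeZero c hc0.ne').measurableEmbedding
  have hmap : ∀ F : Rn n → ℝ≥0∞, ∫⁻ ξ, F (c • ξ) = ENNReal.ofReal ((2 * Real.pi) ^ n) * ∫⁻ ζ, F ζ
      := fun F => by
    rw [← hemb.lintegral_map, Measure.map_addHaar_smul _ hc0.ne', lintegral_smul_measure,
      smul_eq_mul]
    congr 2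
    rw [finrank_euclideanSpace_fin, abs_of_pos (by positivity), hc, inv_pow, inv_inv]
  have hA : ‖(((2 * Real.pi) ^ (-((n : ℝ) / 2)) : ℝ) : ℂ)‖ₑ ^ 2
      = ENNReal.ofReal (((2 * Real.pi) ^ n)⁻¹) := by
    rw [← ofReal_norm, Complex.norm_real, Real.norm_of_nonneg (by positivity),
      ← ENNReal.ofReal_pow (by positivity), ← Real.rpow_natCast, ← Real.rpow_natCast,
      ← Real.rpow_mul (by positivity), ← Real.rpow_neg (by positivity)]
    congr 2
    push_cast
    ring
  have e : ∀ ξ : Rn n, ENNReal.ofReal (Real.exp (2 * inner ℝ (k • l) ξ)) *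
      ‖unitaryFourier u ξ‖ₑ ^ 2 = ENNReal.ofReal (((2 * Real.pi) ^ n)⁻¹) *
      (fun ζ => ENNReal.ofReal (Real.exp (2 * inner ℝ ((2 * Real.pi * k) • l) ζ)) *
        ‖(𝓕 u : L2Rn n) ζ‖ₑ ^ 2) (c • ξ) := fun ξ => by
    rw [unitaryFourier, enorm_mul, mul_pow, hA, mul_left_comm]
    congr 4
    simp only [real_inner_smul_left, inner_smul_right, hc]
    field_simp
  simp only [e]
  rw [lintegral_const_mul' _ _ ENNReal.ofReal_ne_top, hmap fun ζ =>
    ENNReal.ofReal (Real.exp (2 * inner ℝ ((2 * Real.pi * k) • l) ζ)) *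
      ‖(𝓕 u : L2Rn n) ζ‖ₑ ^ 2, ← mul_assoc,
    ← ENNReal.ofReal_mul (by positivity), inv_mul_cancel₀ (by positivity), ENNReal.ofReal_one,
    one_mul]

theorem interactionNorm_linear_le {u v : L2Rn n} {f₀ g₀ f₁ g₁ : Rn n → ℂ}
    (hf₀ : AEStronglyMeasurable f₀ volume) (hg₀ : AEStronglyMeasurable g₀ volume)
    (hf₁ : AEStronglyMeasurable f₁ volume) (hg₁ : AEStronglyMeasurable g₁ volume)
    {t k k₀ k₁ θ : ℝ} (hθ₁ : θ ≤ 1) (hθ₀ : 0 ≤ θ)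
    (hu : ∀ l : Rn n, expNorm (k • l) (freeSchrodinger t u)
      ≤ expNorm (k₀ • l) f₀ ^ θ * expNorm (k₁ • l) f₁ ^ (1 - θ))
    (hv : ∀ l : Rn n, expNorm (k • l) (freeSchrodinger t v)
      ≤ expNorm (k₀ • l) g₀ ^ θ * expNorm (k₁ • l) g₁ ^ (1 - θ)) (l : Rn n) :
    interactionNorm (fun z => k * inner ℝ l z) (freeSchrodinger t u) (freeSchrodinger t v)
      ≤ interactionNorm (fun z => k₀ * inner ℝ l z) f₀ g₀ ^ θ *
        interactionNorm (fun z => k₁ * inner ℝ l z) f₁ g₁ ^ (1 - θ) := by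
  rw [interactionNorm_linear (Lp.aestronglyMeasurable _) (Lp.aestronglyMeasurable _),
    interactionNorm_linear hf₀ hg₀, interactionNorm_linear hf₁ hg₁,
    ENNReal.mul_rpow_of_nonneg _ _ hθ₀, ENNReal.mul_rpow_of_nonneg _ _ (sub_nonneg.2 hθ₁),
    mul_mul_mul_comm]
  -- The second particle carries the weight with parameter `-l`, so its bound is needed for every
  -- vector.
  exact mul_le_mul' (hu l) (hv (-l))

end TwoParticles

/-! ### The exponents as barycentric coordinates, and the theorem. -/

section Exponents

variable {α β T t : ℝ}

theorem thetaExp_nonneg (hα : 0 < α) (hβ : 0 < β) (hT : 0 < T) (ht : 0 ≤ t) (htT : t ≤ T) :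
    0 ≤ thetaExp α β T t := by
  have := sub_nonneg.2 htT
  unfold thetaExp
  positivity

theorem thetaExp_le_one (hα : 0 < α) (hβ : 0 < β) (hT : 0 < T) (ht : 0 ≤ t) :
    thetaExp α β T t ≤ 1 := by
  unfold thetaExp
  rw [div_le_one (by positivity)]
  nlinarith [mul_nonneg (mul_nonneg hα.le ht) hT.le, mul_nonneg hβ.le ht]

theorem muExp_nonneg (hα : 0 < α) (hβ : 0 < β) (ht : 0 ≤ t) : 0 ≤ muExp α β t := by
  unfold muExp
  positivity

theorem muExp_le_one (hα : 0 < α) (hβ : 0 < β) (ht : 0 ≤ t) : muExp α β t ≤ 1 := by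
  unfold muExp
  rw [div_le_one (by positivity)]
  nlinarith [mul_nonneg hα.le ht]

theorem expNorm_freeSchrodinger_le {n : ℕ} (hα : 0 < α) (hβ : 0 < β) (hT : 0 < T) (ht : 0 ≤ t)
    (htT : t ≤ T) (u : L2Rn n) (l : Rn n) :
    expNorm ((α * t + β)⁻¹ • l) (freeSchrodinger t u) ≤ expNorm (β⁻¹ • l) u ^ thetaExp α β T t *
      expNorm ((α * T + β)⁻¹ • l) (freeSchrodinger T u) ^ (1 - thetaExp α β T t) := by
  have h1 : 0 < α * t + β := by positivity
  have h2 : 0 < α * T + β := by positivity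
  have h₀ := endpointBound_freeSchrodinger 0 β⁻¹ l u
  rw [freeSchrodinger_zero] at h₀
  refine expNorm_le_of_endpointBound h₀ (endpointBound_freeSchrodinger T _ l u)
    (thetaExp_nonneg hα hβ hT ht htT) (thetaExp_le_one hα hβ hT ht) ?_ ?_
  · unfold thetaExp
    field_simp
    ring
  · unfold thetaExp
    field_simp
    ring

theorem expNorm_freeSchrodinger_le_fourier {n : ℕ} (hα : 0 < α) (hβ : 0 < β) (ht : 0 ≤ t)
    (u : L2Rn n) (l : Rn n) :
    expNorm ((α * t + β)⁻¹ • l) (freeSchrodinger t u) ≤ expNorm (β⁻¹ • l) u ^ muExp α β t *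
      expNorm ((2 / α) • l) (unitaryFourier u) ^ (1 - muExp α β t) := by
  have h1 : 0 < α * t + β := by positivity
  have h₀ := endpointBound_freeSchrodinger 0 β⁻¹ l u
  rw [freeSchrodinger_zero] at h₀
  rw [expNorm_unitaryFourier]
  refine expNorm_le_of_endpointBound h₀ (endpointBound_fourier _ l u)
    (muExp_nonneg hα hβ ht) (muExp_le_one hα hβ ht) ?_ ?_
  · unfold muExp
    field_simp
    ring
  · unfold muExp
    field_simp
    ring

end Exponents

theorem corollary3p4 (n : ℕ) (α β : ℝ) (hα : 0 < α) (hβ : 0 < β) (u₀ v₀ : L2Rn n) :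
    (∀ (l : Rn n) (T t : ℝ), 0 < T → 0 ≤ t → t ≤ T →
      interactionNorm (fun z => inner ℝ l z / (α * t + β))
          (freeSchrodinger t u₀) (freeSchrodinger t v₀)
        ≤ interactionNorm (fun z => inner ℝ l z / β) u₀ v₀ ^ thetaExp α β T t
          * interactionNorm (fun z => inner ℝ l z / (α * T + β))
              (freeSchrodinger T u₀) (freeSchrodinger T v₀) ^ (1 - thetaExp α β T t)) ∧
    (∀ T t : ℝ, 0 < T → 0 ≤ t → t ≤ T →
      interactionNorm (fun z => ‖z‖ ^ 2 / (α * t + β) ^ 2)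
          (freeSchrodinger t u₀) (freeSchrodinger t v₀)
        ≤ interactionNorm (fun z => ‖z‖ ^ 2 / β ^ 2) u₀ v₀ ^ thetaExp α β T t
          * interactionNorm (fun z => ‖z‖ ^ 2 / (α * T + β) ^ 2)
              (freeSchrodinger T u₀) (freeSchrodinger T v₀) ^ (1 - thetaExp α β T t)) ∧
    (∀ (l : Rn n) (t : ℝ), 0 ≤ t →
      interactionNorm (fun z => inner ℝ l z / (α * t + β))
          (freeSchrodinger t u₀) (freeSchrodinger t v₀)
        ≤ interactionNorm (fun z => inner ℝ l z / β) u₀ v₀ ^ muExp α β t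
          * interactionNorm (fun ζ => 2 * inner ℝ l ζ / α)
              (unitaryFourier u₀) (unitaryFourier v₀) ^ (1 - muExp α β t)) ∧
    (∀ t : ℝ, 0 ≤ t →
      interactionNorm (fun z => ‖z‖ ^ 2 / (α * t + β) ^ 2)
          (freeSchrodinger t u₀) (freeSchrodinger t v₀)
        ≤ interactionNorm (fun z => ‖z‖ ^ 2 / β ^ 2) u₀ v₀ ^ muExp α β t
          * interactionNorm (fun ζ => 4 * ‖ζ‖ ^ 2 / α ^ 2)
              (unitaryFourier u₀) (unitaryFourier v₀) ^ (1 - muExp α β t)) := by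
  -- All weights are brought to the forms `k l·z` and `k²‖z‖²` with a common `k`, equal to
  -- `1/(αt+β)` or, on the Fourier side, `2/α`; this is the pairing of weights that the Gaussian
  -- average produces.
  have hL : ∀ l : Rn n, ∀ c : ℝ, (fun z : Rn n => inner ℝ l z / c) = fun z => c⁻¹ * inner ℝ l z :=
    fun l c => funext fun z => div_eq_inv_mul _ _
  have hL' : ∀ l : Rn n, (fun z : Rn n => 2 * inner ℝ l z / α) = fun z => 2 / α * inner ℝ l z :=
    fun l => funext fun z => by ring
  have hQ : ∀ c : ℝ, (fun z : Rn n => ‖z‖ ^ 2 / c ^ 2) = fun z => c⁻¹ ^ 2 * ‖z‖ ^ 2 :=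
    fun c => funext fun z => by rw [inv_pow, div_eq_inv_mul]
  have hQ' : (fun z : Rn n => 4 * ‖z‖ ^ 2 / α ^ 2) = fun z => (2 / α) ^ 2 * ‖z‖ ^ 2 :=
    funext fun z => by ring
  simp only [hL, hL', hQ, hQ']
  have hm : ∀ w : L2Rn n, AEStronglyMeasurable w volume := fun w => Lp.aestronglyMeasurable w
  have h₁ : ∀ T t : ℝ, 0 < T → 0 ≤ t → t ≤ T → ∀ l : Rn n, _ := fun T t hT ht htT =>
    interactionNorm_linear_le (hm u₀) (hm v₀) (hm (freeSchrodinger T u₀))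
      (hm (freeSchrodinger T v₀)) (thetaExp_le_one hα hβ hT ht)
      (thetaExp_nonneg hα hβ hT ht htT) (expNorm_freeSchrodinger_le hα hβ hT ht htT u₀)
      (expNorm_freeSchrodinger_le hα hβ hT ht htT v₀)
  have h₂ : ∀ t : ℝ, 0 ≤ t → ∀ l : Rn n, _ := fun t ht =>
    interactionNorm_linear_le (hm u₀) (hm v₀) (aestronglyMeasurable_unitaryFourier u₀)
      (aestronglyMeasurable_unitaryFourier v₀) (muExp_le_one hα hβ ht)
      (muExp_nonneg hα hβ ht) (expNorm_freeSchrodinger_le_fourier hα hβ ht u₀)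
      (expNorm_freeSchrodinger_le_fourier hα hβ ht v₀)
  refine ⟨fun l T t hT ht htT => h₁ T t hT ht htT l, fun T t hT ht htT => ?_,
    fun l t ht => h₂ t ht l, fun t ht => ?_⟩
  · exact interactionNorm_quadratic_le (hm _) (hm _) (hm _) (hm _) (hm _) (hm _)
      (thetaExp_nonneg hα hβ hT ht htT) (thetaExp_le_one hα hβ hT ht) (h₁ T t hT ht htT)
  · exact interactionNorm_quadratic_le (hm _) (hm _) (hm _) (hm _)
      (aestronglyMeasurable_unitaryFourier u₀) (aestronglyMeasurable_unitaryFourier v₀)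
      (muExp_nonneg hα hβ ht) (muExp_le_one hα hβ ht) (h₂ t ht)
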